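/- Let $\Omega$ be a finite set and let $(Q_\lambda)_{\lambda\in(0,1]}$ be stochastic matrices over $\Omega$ such that, for all $\omega,\omega'\in\Omega$, $Q_\lambda(\omega,\omega')\sim c_{\omega,\omega'}\lambda^{e_{\omega,\omega'}}$ as $\lambda\to0^+$, with $c_{\omega,\omega'},e_{\omega,\omega'}\ge 0$ (if $c_{\omega,\omega'}=0$ this means that $Q_\lambda(\omega,\omega')=0$ for all small $\lambda$). Let $Q_0:=\lim_{\lambda\to0^+}Q_\lambda$ and let $N$ be the product of the periods of the recurrence classes of $Q_0$. Then the following hold. (1) For every $t>0$ the limit $$P_t:=\lim_{\lambda\to0^+}\frac1N\sum_{m=0}^{N-1}Q_\lambda^{\lfloor t/\lambda\rfloor+m}$$ exists, and the limit $P_0:=\lim_{t\to0^+}P_t$ exists. Moreover, for $t>0$ and any integer $n\ge1$, if $\frac1n\sum_{m=0}^{n-1}Q_\lambda^{\lfloor t/\lambda\rfloor+m}$ converges as $\lambda\to0^+$, then its limit is $P_t$. (The case $n=1$ concerns the limit of $Q_\lambda^{\lfloor t/\lambda\rfloor}$ itself.) (2) There are $L\le|\Omega|$, pairwise disjoint nonempty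 sets $R_1,\dots,R_L\subset\Omega$, and matrices $\mu\in\mathbb R^{\Omega\times L}$, $A\in\mathbb R^{L\times L}$, $M\in\mathbb R^{L\times\Omega}$ such that $$P_t=\mu\, e^{At}M\qquad\text{for all }t\ge0,$$ where the rows of $\mu$ and of $M$ are probability vectors, $\mu(\omega,\ell)=1$ for $\omega\in R_\ell$, the row $M(\ell,\cdot)$ is supported in $R_\ell$, and $A$ is an infinitesimal generator (its off-diagonal entries are nonnegative and its rows sum to $0$). (3) Let $L,R,\mu,A,M$ be any data as in (2). Let $J_1,\dots,J_r$ be the Jordan blocks of the Jordan canonical form of $A$ over $\mathbb C$, where $J_i$ has eigenvalue $v_i$ and size $m_i\ge1$. For $t\in[0,1)$ let $p_t:=P_{-\ln(1-t)}$ be the position at the fraction $t$ of the game. Then there are complex coefficients $a_{i,k}(\omega,\omega')$, independent of $t$, such that for all $t\in[0,1)$ and all $\omega,\omega'\in\Omega$, $$p_t(\omega,\omega')=\sum_{i=1}^r\sum_{k=0}^{m_i-1}a_{i,k}(\omega,\omega')\,(1-t)^{-v_i}\,\bigl(\ln(1-t)\bigr)^k .$$ -/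

import Mathlib

open Filter Topology Asymptotics

/-- The family `Q` of matrices over `Ω`, indexed by the discount rate `lam ∈ (0, 1]`, consists of
stochastic matrices, and each entry satisfies `Q lam x y ∼ c x y * lam ^ e x y` as `lam → 0+`, with
`c x y ≥ 0` and `e x y ≥ 0`. If `c x y = 0`, this says that the entry vanishes for all small `lam`,
and the number `e x y` carries no information (the exponent is then infinite by convention). -/
structure IsRegularFamily {Ω : Type*} [Fintype Ω] [DecidableEq Ω]
    (Q : ℝ → Matrix Ω Ω ℝ) (c e : Ω → Ω → ℝ) : Prop where
  stochastic : ∀ lam ∈ Set.Ioc (0 : ℝ) 1, Q lam ∈ Matrix.rowStochastic ℝ Ω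
  coeff_nonneg : ∀ x y, 0 ≤ c x y
  exponent_nonneg : ∀ x y, 0 ≤ e x y
  equivalent : ∀ x y,
    (fun lam : ℝ => Q lam x y) ~[𝓝[>] (0 : ℝ)] (fun lam : ℝ => c x y * lam ^ e x y)

/-- `C` is a recurrence class (a closed communicating class) of the nonnegative matrix `S`. -/
def IsRecurrenceClass {Ω : Type*} [Fintype Ω] [DecidableEq Ω]
    (S : Matrix Ω Ω ℝ) (C : Finset Ω) : Prop :=
  C.Nonempty ∧ ∀ x ∈ C, ∀ y, (∃ n : ℕ, 0 < (S ^ n) x y) ↔ y ∈ C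

/-- The period of a recurrence class `C` of the nonnegative matrix `S`: the greatest common divisor
of all return times `n ≥ 1` to states of `C`. -/
noncomputable def classPeriod {Ω : Type*} [Fintype Ω] [DecidableEq Ω]
    (S : Matrix Ω Ω ℝ) (C : Finset Ω) : ℕ :=
  sSup {d : ℕ | ∀ n : ℕ, 0 < n → ∀ x ∈ C, 0 < (S ^ n) x x → d ∣ n}

open Classical in
/-- The product of the periods of the recurrence classes of the nonnegative matrix `S`. -/
noncomputable def periodProduct {Ω : Type*} [Fintype Ω] [DecidableEq Ω]
    (S : Matrix Ω Ω ℝ) : ℕ :=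
  ∏ C ∈ (Finset.univ : Finset (Finset Ω)).filter (fun C => IsRecurrenceClass S C), classPeriod S C

open Classical in
/-- The stochastic matrix `Q_0 = lim Q lam` (as `lam → 0+`) of a family with coefficients `c` and
exponents `e`. -/
noncomputable def limitMatrix {Ω : Type*} (c e : Ω → Ω → ℝ) : Matrix Ω Ω ℝ :=
  Matrix.of fun x y => if e x y = 0 then c x y else 0

/-- `B` is the limit, as `lam → 0+`, of the averages over `n` consecutive stages
`(1 / n) * ∑_{m < n} Q lam ^ (⌊t / lam⌋ + m)`. -/
def IsAveragedPosition {Ω : Type*} [Fintype Ω] [DecidableEq Ω]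
    (Q : ℝ → Matrix Ω Ω ℝ) (n : ℕ) (t : ℝ) (B : Matrix Ω Ω ℝ) : Prop :=
  Tendsto (fun lam : ℝ => (n : ℝ)⁻¹ • ∑ m ∈ Finset.range n, Q lam ^ (⌊t / lam⌋₊ + m))
    (𝓝[>] (0 : ℝ)) (𝓝 B)

/-- `P t` is, for every `t ≥ 0`, the position at time `t`: for `t > 0` it is the limit of the
averages over `N` stages, where `N` is the product of the periods of the recurrence classes of the
limit matrix; it is also the limit of the averages over any other number of stages for which that
limit exists (with one stage: the limit of `Q lam ^ ⌊t / lam⌋` itself); and `P 0` is the limit of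
`P t` as `t → 0+`. -/
structure IsPosition {Ω : Type*} [Fintype Ω] [DecidableEq Ω]
    (Q : ℝ → Matrix Ω Ω ℝ) (c e : Ω → Ω → ℝ) (P : ℝ → Matrix Ω Ω ℝ) : Prop where
  limit : ∀ t : ℝ, 0 < t → IsAveragedPosition Q (periodProduct (limitMatrix c e)) t (P t)
  limit_unique : ∀ t : ℝ, 0 < t → ∀ n : ℕ, 0 < n → ∀ B : Matrix Ω Ω ℝ,
    IsAveragedPosition Q n t B → B = P t
  limit_zero : Tendsto P (𝓝[>] (0 : ℝ)) (𝓝 (P 0))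

/-- The position at the fraction `t ∈ [0, 1)` of the game. -/
noncomputable def positionAtFraction {Ω : Type*} (P : ℝ → Matrix Ω Ω ℝ) (t : ℝ) : Matrix Ω Ω ℝ :=
  P (-Real.log (1 - t))

/-- `A` is the infinitesimal generator of a continuous-time Markov chain on `L` states. -/
def IsGenerator {L : ℕ} (A : Matrix (Fin L) (Fin L) ℝ) : Prop :=
  (∀ i j, i ≠ j → 0 ≤ A i j) ∧ ∀ i, ∑ j, A i j = 0

/-- The representation `P t = μ * exp (t A) * M` for all `t ≥ 0`, where `R 0, …, R (L - 1)` are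
disjoint nonempty sets of states, `μ` gives the entrance laws to these sets, `A` is the
infinitesimal generator of a Markov process on them, and `M i` is the law of the frequencies of
visits to the states in `R i`. -/
structure IsRepresentation {Ω : Type*} [Fintype Ω] [DecidableEq Ω]
    (P : ℝ → Matrix Ω Ω ℝ) {L : ℕ} (R : Fin L → Finset Ω) (μ : Matrix Ω (Fin L) ℝ)
    (A : Matrix (Fin L) (Fin L) ℝ) (M : Matrix (Fin L) Ω ℝ) : Prop where
  nonempty : ∀ i, (R i).Nonempty
  disjoint : Pairwise fun i j => Disjoint (R i) (R j)
  entrance_mem : ∀ x, μ x ∈ stdSimplex ℝ (Fin L)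
  entrance_self : ∀ i, ∀ x ∈ R i, μ x i = 1
  generator : IsGenerator A
  frequency_mem : ∀ i, M i ∈ stdSimplex ℝ Ω
  frequency_support : ∀ i, ∀ x, x ∉ R i → M i x = 0
  eq_exp : ∀ t : ℝ, 0 ≤ t → P t = μ * NormedSpace.exp (t • A) * M

/-- The Jordan block of size `m` with eigenvalue `v`. -/
def jordanBlock (v : ℂ) (m : ℕ) : Matrix (Fin m) (Fin m) ℂ :=
  Matrix.of fun i j => if i = j then v else if (j : ℕ) = (i : ℕ) + 1 then 1 else 0

/-- The Jordan canonical form of `B` has the blocks of sizes `m i ≥ 1` with eigenvalues `v i`. -/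
def HasJordanForm {L r : ℕ} (B : Matrix (Fin L) (Fin L) ℂ) (v : Fin r → ℂ) (m : Fin r → ℕ) : Prop :=
  (∀ i, 0 < m i) ∧
    ∃ (S : Matrix (Fin L) ((i : Fin r) × Fin (m i)) ℂ)
      (T : Matrix ((i : Fin r) × Fin (m i)) (Fin L) ℂ),
      S * T = 1 ∧ T * S = 1 ∧
        B = S * Matrix.blockDiagonal' (fun i => jordanBlock (v i) (m i)) * T

/-!
The powers `Q lam ^ n` are studied along pairs with `lam → 0+` and `n * lam → t` (`scaleFilter`).

*Resolvents.* The matrix `lam * ((1 + s * lam) - T lam)⁻¹`, for `s > 0` real, is the potential of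
a chain killed at rate `s * lam`. Eliminating the states one at a time uses only sums, products
and quotients of nonnegative functions, all of which preserve equivalence to a monomial
`c * lam ^ e`; being bounded, the potentials therefore converge (`exists_tendsto_resolvent`). No
hierarchy of time scales has to be analysed. A Neumann series extends the convergence to complex
`s` in the right half-plane (`exists_tendsto_rescaled_resolvent`).

*A uniform bound.* To pass from resolvents to powers one needs `‖z - 1‖ * ‖(z - T)⁻¹‖ ≤ C` for
`1 < ‖z‖ ≤ 3`, uniformly as `lam → 0+`. Near `z = 1` this holds with the same constants for all
stochastic matrices of a given size: the maximum principle applies at a state where the values of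
a complex vector are supported by a tangent of a logarithmic spiral, and finitely many points of
the plane always have such a support (`exists_spiral_support`, `exists_sectorial_bound`). Away
from `1` it follows by compactness, provided that the limit of `T lam` has no other eigenvalue on
the unit circle. With `S` the limit matrix and `N` the product of its periods, this is the case
for `T lam = Q lam ^ N`, since the peripheral eigenvalues of `S` are `N`-th roots of unity
(`eigenvalue_pow_periodProduct`, `exists_ritt_bound`).

*Powers.* Cauchy's formula expresses `T ^ k` as an integral of the square of the resolvent over
the circle of radius `exp (1 / k)`. After rescaling the angle by `k`, the integrand is dominated
by a multiple of `1 / (1 + y ^ 2)` and converges pointwise, so that `(Q lam ^ N) ^ k` converges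
when `k * lam → τ > 0` (`tendsto_pow_of_tendsto_resolvent`, `IsRegularFamily.exists_tendsto_pow`).
Averaging over `N` stages removes the dependence on the residue of the exponent modulo `N`. Any
other average that converges is compared with it along the sequences `lam = t / (N * i + j)`
(`IsRegularFamily.averagedPosition_eq`).

*Representation.* The limits `P t` form a continuous semigroup of stochastic matrices on `(0, ∞)`.
By compactness it has a limit `P 0` at `0+`, which is a stochastic projection; such a projection
factors as `μ * M` with `M * μ = 1` through its recurrence classes
(`exists_factorization_of_stochastic_idempotent`). Then `M * P t * μ` is a continuous semigroup of
stochastic matrices that starts at the identity, hence `exp (t A)` with `A` a generator, and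
`P t = μ * exp (t A) * M` (`exists_isRepresentation`). The expansion of `P (-log (1 - t))` is read
off the exponential of the Jordan form of `A` (`exists_jordan_expansion`).
-/

/-! ### Monomial asymptotics and elimination of states -/

/-- `f` is equivalent to a monomial `c * lam ^ e` with `c ≥ 0` as `lam → 0+`; when `c = 0` this
means that `f` vanishes near `0+`. The exponent may be negative, so that the class is closed under
inversion. -/
def HasMonomialAsymptotics (f : ℝ → ℝ) : Prop :=
  ∃ c e : ℝ, 0 ≤ c ∧ f ~[𝓝[>] (0 : ℝ)] (fun lam : ℝ => c * lam ^ e)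

namespace HasMonomialAsymptotics

theorem const {c : ℝ} (hc : 0 ≤ c) : HasMonomialAsymptotics (fun _ => c) :=
  ⟨c, 0, hc, by simpa using IsEquivalent.refl⟩

theorem const_mul_id {c : ℝ} (hc : 0 ≤ c) : HasMonomialAsymptotics (fun lam => c * lam) :=
  ⟨c, 1, hc, by simpa using IsEquivalent.refl⟩

theorem mul {f g : ℝ → ℝ} (hf : HasMonomialAsymptotics f) (hg : HasMonomialAsymptotics g) :
    HasMonomialAsymptotics (fun lam => f lam * g lam) := by
  obtain ⟨c, e, hc, h⟩ := hf
  obtain ⟨c', e', hc', h'⟩ := hg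
  refine ⟨c * c', e + e', mul_nonneg hc hc', (h.mul h').congr_right ?_⟩
  filter_upwards [self_mem_nhdsWithin] with lam (hlam : 0 < lam)
  simp only [Pi.mul_apply, Real.rpow_add hlam]
  ring

theorem inv {f : ℝ → ℝ} (hf : HasMonomialAsymptotics f) :
    HasMonomialAsymptotics (fun lam => (f lam)⁻¹) := by
  obtain ⟨c, e, hc, h⟩ := hf
  refine ⟨c⁻¹, -e, inv_nonneg.2 hc, h.inv.congr_right ?_⟩
  filter_upwards [self_mem_nhdsWithin] with lam (hlam : 0 < lam)
  simp [Real.rpow_neg hlam.le, mul_comm]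

theorem div {f g : ℝ → ℝ} (hf : HasMonomialAsymptotics f) (hg : HasMonomialAsymptotics g) :
    HasMonomialAsymptotics (fun lam => f lam / g lam) := by
  simpa only [div_eq_mul_inv] using hf.mul hg.inv

theorem tendsto_rpow_zero {e : ℝ} (he : 0 < e) :
    Tendsto (fun lam : ℝ => lam ^ e) (𝓝[>] (0 : ℝ)) (𝓝 0) := by
  have h := (Real.continuousAt_rpow_const 0 e (Or.inr he.le)).tendsto
  rw [Real.zero_rpow he.ne'] at h
  exact h.mono_left nhdsWithin_le_nhds

/-- Of two monomials with different exponents, the one with the larger exponent is negligible. -/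
theorem monomial_add {c c' e e' : ℝ} (hc : 0 < c) (h : e < e') :
    (fun lam : ℝ => c * lam ^ e + c' * lam ^ e') ~[𝓝[>] (0 : ℝ)] (fun lam : ℝ => c * lam ^ e) := by
  have hlit : (fun lam : ℝ => c' * lam ^ e') =o[𝓝[>] (0 : ℝ)] (fun lam : ℝ => c * lam ^ e) := by
    refine isLittleO_of_tendsto' ?_ ?_
    · filter_upwards [self_mem_nhdsWithin] with lam (hlam : 0 < lam) h0
      have := mul_pos hc (Real.rpow_pos_of_pos hlam e)
      exact absurd h0 this.ne'
    · have h1 := (tendsto_rpow_zero (sub_pos.2 h)).const_mul (c' / c)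
      rw [mul_zero] at h1
      refine h1.congr' ?_
      filter_upwards [self_mem_nhdsWithin] with lam (hlam : 0 < lam)
      rw [Real.rpow_sub hlam]
      field_simp
  exact (IsEquivalent.refl (u := fun lam : ℝ => c * lam ^ e)).add_isLittleO hlit

theorem add {f g : ℝ → ℝ} (hf : HasMonomialAsymptotics f) (hg : HasMonomialAsymptotics g) :
    HasMonomialAsymptotics (fun lam => f lam + g lam) := by
  obtain ⟨c, e, hc, h⟩ := hf
  obtain ⟨c', e', hc', h'⟩ := hg
  rcases hc.eq_or_lt with rfl | hc0
  · refine ⟨c', e', hc', (EventuallyEq.trans_isEquivalent ?_ h')⟩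
    have h0 : f =ᶠ[𝓝[>] (0 : ℝ)] 0 := isEquivalent_zero_iff_eventually_zero.1
      (by simpa [Pi.zero_def] using h)
    filter_upwards [h0] with lam h1
    simp [h1]
  rcases hc'.eq_or_lt with rfl | hc0'
  · refine ⟨c, e, hc, (EventuallyEq.trans_isEquivalent ?_ h)⟩
    have h0 : g =ᶠ[𝓝[>] (0 : ℝ)] 0 := isEquivalent_zero_iff_eventually_zero.1
      (by simpa [Pi.zero_def] using h')
    filter_upwards [h0] with lam h1
    simp [h1]
  -- Absolute values make the monomials nonnegative everywhere, as `add_add_of_nonneg` requires.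
  have key : (fun lam => f lam + g lam) ~[𝓝[>] (0 : ℝ)]
      (fun lam : ℝ => c * lam ^ e + c' * lam ^ e') := by
    have e1 : (fun lam : ℝ => c * lam ^ e) =ᶠ[𝓝[>] (0 : ℝ)] fun lam => |c * lam ^ e| := by
      filter_upwards [self_mem_nhdsWithin] with lam (hlam : 0 < lam)
      rw [abs_of_nonneg (mul_nonneg hc (Real.rpow_nonneg hlam.le e))]
    have e2 : (fun lam : ℝ => c' * lam ^ e') =ᶠ[𝓝[>] (0 : ℝ)] fun lam => |c' * lam ^ e'| := by
      filter_upwards [self_mem_nhdsWithin] with lam (hlam : 0 < lam)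
      rw [abs_of_nonneg (mul_nonneg hc' (Real.rpow_nonneg hlam.le e'))]
    exact (IsEquivalent.add_add_of_nonneg (fun lam => abs_nonneg _) (fun lam => abs_nonneg _)
      (h.congr_right e1) (h'.congr_right e2)).congr_right (e1.add e2).symm
  rcases lt_trichotomy e e' with hlt | rfl | hlt
  · exact ⟨c, e, hc, key.trans (monomial_add hc0 hlt)⟩
  · exact ⟨c + c', e, add_nonneg hc hc', by simpa only [add_mul] using key⟩
  · refine ⟨c', e', hc', key.trans ?_⟩
    simpa only [add_comm] using monomial_add (c' := c) hc0' hlt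

theorem sum {ι : Type*} (s : Finset ι) {f : ι → ℝ → ℝ}
    (hf : ∀ i ∈ s, HasMonomialAsymptotics (f i)) :
    HasMonomialAsymptotics (fun lam => ∑ i ∈ s, f i lam) := by
  classical
  induction s using Finset.induction_on with
  | empty => simpa using const le_rfl
  | insert a s ha ih =>
    simp only [Finset.sum_insert ha]
    exact (hf a (Finset.mem_insert_self a s)).add
      (ih fun i hi => hf i (Finset.mem_insert_of_mem hi))

/-- A bounded function with monomial asymptotics converges, since its exponent cannot be negative
unless its coefficient vanishes. -/
theorem exists_tendsto {f : ℝ → ℝ} (hf : HasMonomialAsymptotics f) {B : ℝ}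
    (hB : ∀ᶠ lam in 𝓝[>] (0 : ℝ), |f lam| ≤ B) : ∃ a, Tendsto f (𝓝[>] (0 : ℝ)) (𝓝 a) := by
  obtain ⟨c, e, hc, h⟩ := hf
  rcases hc.eq_or_lt with rfl | hc0
  · refine ⟨0, h.symm.tendsto_nhds ?_⟩
    simp
  rcases lt_trichotomy e 0 with he | rfl | he
  · exfalso
    have h1 : Tendsto (fun lam : ℝ => c * lam ^ e) (𝓝[>] (0 : ℝ)) atTop := by
      refine Tendsto.const_mul_atTop hc0 ?_
      have := (tendsto_rpow_zero (neg_pos.2 he))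
      have h2 : Tendsto (fun lam : ℝ => lam ^ (-e)) (𝓝[>] (0 : ℝ)) (𝓝[>] 0) :=
        tendsto_nhdsWithin_iff.2 ⟨this, by
          filter_upwards [self_mem_nhdsWithin] with lam (hlam : 0 < lam)
          exact Real.rpow_pos_of_pos hlam _⟩
      refine (tendsto_inv_nhdsGT_zero.comp h2).congr' ?_
      filter_upwards [self_mem_nhdsWithin] with lam (hlam : 0 < lam)
      simp [Real.rpow_neg hlam.le]
    have h3 := h.symm.tendsto_atTop h1
    obtain ⟨lam, h4, h5⟩ := (hB.and (h3.eventually_gt_atTop B)).exists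
    exact absurd ((le_abs_self _).trans h4) (not_le.2 h5)
  · refine ⟨c, h.symm.tendsto_nhds ?_⟩
    simp
  · refine ⟨0, h.symm.tendsto_nhds ?_⟩
    simpa using (tendsto_rpow_zero he).const_mul c

end HasMonomialAsymptotics

/-- A killed Markov chain with killing rates `k` and jump rates `g`, all with monomial asymptotics,
has potentials with monomial asymptotics. States are eliminated one at a time: eliminating a state
only adds, multiplies and divides nonnegative quantities, and no cancellation can occur. -/
theorem exists_potential_hasMonomialAsymptotics (S : Set ℝ) (n : ℕ) :
    ∀ (k b : Fin n → ℝ → ℝ) (g : Fin n → Fin n → ℝ → ℝ),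
      (∀ x, HasMonomialAsymptotics (k x)) → (∀ x, HasMonomialAsymptotics (b x)) →
      (∀ x y, HasMonomialAsymptotics (g x y)) →
      (∀ lam ∈ S, ∀ x, 0 < k x lam) → (∀ lam ∈ S, ∀ x y, 0 ≤ g x y lam) →
      ∃ u : Fin n → ℝ → ℝ, (∀ x, HasMonomialAsymptotics (u x)) ∧
        ∀ lam ∈ S, ∀ x,
          (k x lam + ∑ y, g x y lam) * u x lam = ∑ y, g x y lam * u y lam + b x lam := by
  induction n with
  | zero => exact fun _ _ _ _ _ _ _ _ => ⟨fun _ _ => 0, fun x => x.elim0, fun _ _ x => x.elim0⟩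
  | succ n ih =>
    intro k b g hk hb hg kpos gnn
    -- `d` is the total rate out of the eliminated state `0`.
    set d : ℝ → ℝ := fun lam => k 0 lam + ∑ y : Fin n, g 0 y.succ lam with hd
    have hdR : HasMonomialAsymptotics d := (hk 0).add (.sum _ fun y _ => hg 0 y.succ)
    have dpos : ∀ lam ∈ S, 0 < d lam := fun lam hl =>
      add_pos_of_pos_of_nonneg (kpos lam hl 0) (Finset.sum_nonneg fun y _ => gnn lam hl 0 y.succ)
    obtain ⟨u, hu, hsol⟩ := ih
      (fun x lam => k x.succ lam + g x.succ 0 lam * k 0 lam / d lam)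
      (fun x lam => b x.succ lam + g x.succ 0 lam * b 0 lam / d lam)
      (fun x y lam => g x.succ y.succ lam + g x.succ 0 lam * g 0 y.succ lam / d lam)
      (fun x => (hk _).add (((hg _ _).mul (hk _)).div hdR))
      (fun x => (hb _).add (((hg _ _).mul (hb _)).div hdR))
      (fun x y => (hg _ _).add (((hg _ _).mul (hg _ _)).div hdR))
      (fun lam hl x => add_pos_of_pos_of_nonneg (kpos lam hl _)
        (div_nonneg (mul_nonneg (gnn lam hl _ _) (kpos lam hl _).le) (dpos lam hl).le))
      (fun lam hl x y => add_nonneg (gnn lam hl _ _)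
        (div_nonneg (mul_nonneg (gnn lam hl _ _) (gnn lam hl _ _)) (dpos lam hl).le))
    refine ⟨Fin.cons (fun lam => (b 0 lam + ∑ y : Fin n, g 0 y.succ lam * u y lam) / d lam) u,
      fun x => ?_, fun lam hl x => ?_⟩
    · refine Fin.cases ?_ (fun x => ?_) x
      · exact ((hb 0).add (.sum _ fun y _ => (hg _ _).mul (hu y))).div hdR
      · exact hu x
    · have hdl := (dpos lam hl).ne'
      refine Fin.cases ?_ (fun x => ?_) x
      · simp only [Fin.sum_univ_succ, Fin.cons_zero, Fin.cons_succ]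
        have h1 : d lam = k 0 lam + ∑ y : Fin n, g 0 y.succ lam := rfl
        have h2 : k 0 lam + (g 0 0 lam + ∑ y : Fin n, g 0 y.succ lam) = d lam + g 0 0 lam := by
          rw [h1]; ring
        rw [h2]
        field_simp
        ring
      · simp only [Fin.sum_univ_succ, Fin.cons_zero, Fin.cons_succ]
        have h := hsol lam hl x
        simp only [Finset.sum_add_distrib, add_mul, div_mul_eq_mul_div] at h
        simp only [← Finset.sum_div, mul_assoc, ← Finset.mul_sum] at h
        have h1 : d lam = k 0 lam + ∑ y : Fin n, g 0 y.succ lam := rfl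
        have h3 : (g x.succ 0 lam * (k 0 lam * u x lam)) / d lam
            + g x.succ 0 lam * (∑ y : Fin n, g 0 y.succ lam) / d lam * u x lam
            = g x.succ 0 lam * u x lam := by
          rw [h1] at hdl ⊢
          field_simp
        have h4 : g x.succ 0 lam * ((b 0 lam + ∑ y : Fin n, g 0 y.succ lam * u y lam) / d lam)
            = (g x.succ 0 lam * b 0 lam) / d lam
              + g x.succ 0 lam * (∑ y : Fin n, g 0 y.succ lam * u y lam) / d lam := by
          ring
        rw [h4]
        linear_combination h - h3

theorem HasMonomialAsymptotics.matrix_pow {Ω : Type*} [Fintype Ω] [DecidableEq Ω]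
    {T : ℝ → Matrix Ω Ω ℝ} (hT : ∀ x y, HasMonomialAsymptotics fun lam => T lam x y) (n : ℕ)
    (x y : Ω) : HasMonomialAsymptotics fun lam => (T lam ^ n) x y := by
  induction n generalizing y with
  | zero =>
    simp only [pow_zero, Matrix.one_apply]
    exact .const (by split_ifs <;> simp)
  | succ n ih =>
    simp only [pow_succ, Matrix.mul_apply]
    exact .sum _ fun z _ => (ih z).mul (hT z y)

/-- For stochastic matrices `T lam` whose entries have monomial asymptotics, the rescaled resolvents
`U lam = lam * ((1 + s * lam) - T lam)⁻¹` converge as `lam → 0+`, for every real `s > 0`. -/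
theorem exists_tendsto_resolvent {Ω : Type*} [Fintype Ω] [DecidableEq Ω] {T : ℝ → Matrix Ω Ω ℝ}
    (hT : ∀ lam ∈ Set.Ioc (0 : ℝ) 1, T lam ∈ Matrix.rowStochastic ℝ Ω)
    (hreg : ∀ x y, HasMonomialAsymptotics fun lam => T lam x y) {s : ℝ} (hs : 0 < s) :
    ∃ (V : Matrix Ω Ω ℝ) (U : ℝ → Matrix Ω Ω ℝ),
      (∀ lam ∈ Set.Ioc (0 : ℝ) 1,
        ((1 + s * lam) • (1 : Matrix Ω Ω ℝ) - T lam) * U lam = lam • (1 : Matrix Ω Ω ℝ)) ∧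
      Tendsto U (𝓝[>] (0 : ℝ)) (𝓝 V) := by
  have key : ∀ y : Ω, ∃ u : Ω → ℝ → ℝ, (∀ x, HasMonomialAsymptotics (u x)) ∧
      ∀ lam ∈ Set.Ioc (0 : ℝ) 1, ∀ x, (1 + s * lam) * u x lam
        = ∑ z, T lam x z * u z lam + lam * (1 : Matrix Ω Ω ℝ) x y := by
    intro y
    let e := Fintype.equivFin Ω
    obtain ⟨u, hu, hsol⟩ := exists_potential_hasMonomialAsymptotics (Set.Ioc (0 : ℝ) 1)
      (Fintype.card Ω) (fun _ lam => s * lam)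
      (fun x lam => (1 : Matrix Ω Ω ℝ) (e.symm x) y * lam)
      (fun x z lam => T lam (e.symm x) (e.symm z))
      (fun _ => .const_mul_id hs.le)
      (fun x => .const_mul_id (by rw [Matrix.one_apply]; split_ifs <;> simp))
      (fun x z => hreg _ _) (fun lam hl _ => mul_pos hs hl.1)
      (fun lam hl x z => Matrix.nonneg_of_mem_rowStochastic (hT lam hl))
    refine ⟨fun x => u (e x), fun x => hu _, fun lam hl x => ?_⟩
    have h := hsol lam hl (e x)
    rw [Equiv.sum_comp e.symm (fun z => T lam (e.symm (e x)) z),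
      ← Equiv.sum_comp e (fun z => T lam (e.symm (e x)) (e.symm z) * u z lam)] at h
    simp only [Equiv.symm_apply_apply] at h
    rw [Matrix.sum_row_of_mem_rowStochastic (hT lam hl)] at h
    rw [Equiv.symm_apply_apply] at h
    beta_reduce
    linarith
  choose u hu hsol using key
  have hbound : ∀ x y, ∀ lam ∈ Set.Ioc (0 : ℝ) 1, |u y x lam| ≤ 1 / s := by
    intro x₀ y lam hl
    -- the equation at a state where the absolute value is largest
    obtain ⟨x, -, hx⟩ := Finset.exists_max_image Finset.univ (fun x => |u y x lam|)
      ⟨x₀, Finset.mem_univ _⟩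
    refine (hx x₀ (Finset.mem_univ _)).trans ?_
    have h1 : |∑ z, T lam x z * u y z lam| ≤ |u y x lam| := by
      calc |∑ z, T lam x z * u y z lam| ≤ ∑ z, |T lam x z * u y z lam| :=
            Finset.abs_sum_le_sum_abs _ _
        _ ≤ ∑ z, T lam x z * |u y x lam| := Finset.sum_le_sum fun z hz => by
            rw [abs_mul, abs_of_nonneg (Matrix.nonneg_of_mem_rowStochastic (hT lam hl))]
            exact mul_le_mul_of_nonneg_left (hx z hz)
              (Matrix.nonneg_of_mem_rowStochastic (hT lam hl))
        _ = |u y x lam| := by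
            rw [← Finset.sum_mul, Matrix.sum_row_of_mem_rowStochastic (hT lam hl), one_mul]
    have h2 : |lam * (1 : Matrix Ω Ω ℝ) x y| ≤ lam := by
      rw [Matrix.one_apply]
      split_ifs <;> simp [abs_of_pos hl.1, hl.1.le]
    have hsl : 0 < s * lam := mul_pos hs hl.1
    have h3 : (1 + s * lam) * |u y x lam| ≤ |u y x lam| + lam := by
      have h4 : |(1 + s * lam) * u y x lam| = (1 + s * lam) * |u y x lam| := by
        rw [abs_mul, abs_of_pos (by linarith : 0 < 1 + s * lam)]
      rw [← h4, hsol y lam hl x]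
      exact (abs_add_le _ _).trans (add_le_add h1 h2)
    rw [le_div_iff₀ hs]
    have h5 : (|u y x lam| * s) * lam ≤ 1 * lam := by linarith
    exact le_of_mul_le_mul_right h5 hl.1
  have hmem : ∀ᶠ lam in 𝓝[>] (0 : ℝ), lam ∈ Set.Ioc (0 : ℝ) 1 :=
    Ioc_mem_nhdsGT one_pos
  have hlim : ∀ x y, ∃ a, Tendsto (u y x) (𝓝[>] (0 : ℝ)) (𝓝 a) := fun x y =>
    (hu y x).exists_tendsto (hmem.mono fun lam hl => hbound x y lam hl)
  choose V hV using hlim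
  refine ⟨Matrix.of V, fun lam => Matrix.of fun x y => u y x lam, fun lam hl => ?_,
    tendsto_pi_nhds.2 fun x => tendsto_pi_nhds.2 fun y => hV x y⟩
  ext x y
  have h := hsol y lam hl x
  rw [sub_mul, smul_mul_assoc, one_mul]
  simp only [Matrix.sub_apply, Matrix.smul_apply, Matrix.mul_apply, Matrix.of_apply, smul_eq_mul]
  linarith

/-! ### A resolvent bound for stochastic matrices near `1` -/

/-- The logarithmic spiral `α ↦ exp (-κ α) * exp (i α)` stays in the half-plane
`re w + κ * im w ≤ 1` bounded by its tangent at `α = 0`, as long as `α` stays away from `-2π`. -/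
theorem cos_add_mul_sin_le_exp {κ γ α : ℝ} (hκ : 0 ≤ κ) (hγ : 0 ≤ γ) (hγπ : γ ≤ Real.pi)
    (h : Real.cos γ + κ ≤ Real.exp (-(2 * Real.pi * κ))) (hα : -(2 * Real.pi - γ) ≤ α) :
    Real.cos α + κ * Real.sin α ≤ Real.exp (κ * α) := by
  rcases le_total 0 α with h0 | h0
  · have h1 := Real.add_one_le_exp (κ * α)
    have h2 := mul_le_mul_of_nonneg_left (Real.sin_le h0) hκ
    linarith [Real.cos_le_one α]
  rcases le_total (-Real.pi) α with h1 | h1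
  · -- here `exp (-κ α) * (cos α + κ sin α)` is monotone in `α`
    have hmono : MonotoneOn (fun a => Real.exp (-(κ * a)) * (Real.cos a + κ * Real.sin a))
        (Set.Icc (-Real.pi) 0) := by
      have hder : ∀ a : ℝ, HasDerivAt
          (fun a => Real.exp (-(κ * a)) * (Real.cos a + κ * Real.sin a))
          (-((1 + κ ^ 2) * Real.exp (-(κ * a)) * Real.sin a)) a := by
        intro a
        have e1 : HasDerivAt (fun a => Real.exp (-(κ * a))) (Real.exp (-(κ * a)) * (-κ)) a := by
          have := ((hasDerivAt_id a).const_mul κ).neg.exp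
          simpa using this
        have e2 := (Real.hasDerivAt_cos a).add ((Real.hasDerivAt_sin a).const_mul κ)
        refine (e1.mul e2).congr_deriv ?_
        rw [Pi.add_apply]
        ring
      refine monotoneOn_of_deriv_nonneg (convex_Icc _ _)
        (fun a _ => (hder a).continuousAt.continuousWithinAt)
        (fun a _ => (hder a).differentiableAt.differentiableWithinAt) fun a ha => ?_
      rw [interior_Icc] at ha
      rw [(hder a).deriv, neg_nonneg]
      exact mul_nonpos_of_nonneg_of_nonpos (by positivity)
        (Real.sin_nonpos_of_nonpos_of_neg_pi_le ha.2.le ha.1.le)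
    have h2 := hmono ⟨h1, h0⟩ ⟨by linarith [Real.pi_pos], le_rfl⟩ h0
    simp only [mul_zero, neg_zero, Real.exp_zero, Real.cos_zero, Real.sin_zero, add_zero,
      mul_one, Real.exp_neg] at h2
    rwa [inv_mul_le_iff₀ (Real.exp_pos _), mul_one] at h2
  · have h2 : Real.cos α ≤ Real.cos γ := by
      rw [← Real.cos_neg α, ← Real.cos_two_pi_sub]
      exact Real.cos_le_cos_of_nonneg_of_le_pi hγ (by linarith) (by linarith)
    have h3 : κ * Real.sin α ≤ κ := by
      simpa using mul_le_mul_of_nonneg_left (Real.sin_le_one α) hκ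
    have h4 : Real.exp (-(2 * Real.pi * κ)) ≤ Real.exp (κ * α) := by
      refine Real.exp_le_exp.2 ?_
      nlinarith
    linarith

/-- The arguments of `n` complex numbers leave a gap of length `2π / (n + 1)`, which a rotation
moves next to the branch cut of `Complex.arg`. -/
theorem exists_rotation_arg_le {Ω : Type*} [Fintype Ω] (u : Ω → ℂ) :
    ∃ ω : ℂ, ‖ω‖ = 1 ∧ ∀ y, u y ≠ 0 →
      (ω * u y).arg ≤ Real.pi - 2 * Real.pi / (Fintype.card Ω + 1) := by
  by_contra! hcon
  set n := Fintype.card Ω with hn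
  set γ : ℝ := 2 * Real.pi / (n + 1) with hγ
  have hγ0 : 0 < γ := by positivity
  have hn1 : γ * (n + 1) = 2 * Real.pi := by rw [hγ]; field_simp
  have hω : ∀ j : Fin (n + 1), ‖Complex.exp ((γ * j : ℝ) * Complex.I)‖ = 1 := fun j =>
    Complex.norm_exp_ofReal_mul_I _
  choose y hy using fun j => hcon _ (hω j)
  obtain ⟨j, k, hjk, hyjk⟩ := Fintype.exists_ne_map_eq_of_card_lt y (by simp [← hn])
  have h1 := hy j
  have h2 := hy k
  rw [← hyjk] at h2
  set a := (Complex.exp ((γ * j : ℝ) * Complex.I) * u (y j)).arg with ha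
  set b := (Complex.exp ((γ * k : ℝ) * Complex.I) * u (y j)).arg with hb
  have haπ : a ≤ Real.pi := Complex.arg_le_pi _
  have hbπ : b ≤ Real.pi := Complex.arg_le_pi _
  have e1 : (‖u (y j)‖ : ℂ) * Complex.exp (a * Complex.I)
      = Complex.exp ((γ * j : ℝ) * Complex.I) * u (y j) := by
    have := Complex.norm_mul_exp_arg_mul_I (Complex.exp ((γ * j : ℝ) * Complex.I) * u (y j))
    rwa [norm_mul, hω, one_mul] at this
  have e2 : (‖u (y j)‖ : ℂ) * Complex.exp (b * Complex.I)
      = Complex.exp ((γ * k : ℝ) * Complex.I) * u (y j) := by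
    have := Complex.norm_mul_exp_arg_mul_I (Complex.exp ((γ * k : ℝ) * Complex.I) * u (y j))
    rwa [norm_mul, hω, one_mul] at this
  have hu0 : (‖u (y j)‖ : ℂ) ≠ 0 := by simpa using h1.1
  have e3 : Complex.exp ((a + γ * k : ℝ) * Complex.I)
      = Complex.exp ((b + γ * j : ℝ) * Complex.I) := by
    apply mul_left_cancel₀ hu0
    have f1 : ((a + γ * k : ℝ) : ℂ) * Complex.I = a * Complex.I + (γ * k : ℝ) * Complex.I := by
      push_cast; ring
    have f2 : ((b + γ * j : ℝ) : ℂ) * Complex.I = b * Complex.I + (γ * j : ℝ) * Complex.I := by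
      push_cast; ring
    rw [f1, f2, Complex.exp_add, Complex.exp_add, ← mul_assoc, ← mul_assoc, e1, e2]
    ring
  obtain ⟨m, hm⟩ := Complex.exp_eq_exp_iff_exists_int.1 e3
  have hm' : a + γ * k = b + γ * j + m * (2 * Real.pi) := by
    have := congrArg Complex.im hm
    simpa using this
  -- `(a - b) / γ` is an integer of absolute value less than `1`
  have h3 : a - b = γ * ((j : ℤ) - (k : ℤ) + (n + 1) * m : ℤ) := by
    push_cast
    linear_combination hm' + (m : ℝ) * (-hn1)
  have h4 : |a - b| < γ := by rw [abs_lt]; constructor <;> linarith [h1.2, h2.2]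
  rw [h3, abs_mul, abs_of_pos hγ0] at h4
  have h5 : |(((j : ℤ) - (k : ℤ) + (n + 1) * m : ℤ) : ℝ)| < 1 := by
    by_contra! h6
    linarith [mul_le_mul_of_nonneg_left h6 hγ0.le]
  have h6 : (j : ℤ) - (k : ℤ) + (n + 1) * m = 0 := by
    rw [← Int.cast_abs] at h5
    exact Int.abs_lt_one_iff.1 (by exact_mod_cast h5)
  have hj := j.2
  have hk := k.2
  have h7 : m = 0 := by
    by_contra h0
    rcases lt_or_gt_of_ne h0 with h8 | h8
    · have : ((n : ℤ) + 1) * m ≤ (n + 1) * (-1) := by gcongr; omega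
      omega
    · have : ((n : ℤ) + 1) * 1 ≤ (n + 1) * m := by gcongr; omega
      omega
  subst h7
  exact hjk (Fin.ext (by omega))

/-- Finitely many points of the plane, not all zero, lie in a half-plane bounded by the tangent of a
logarithmic spiral at one of them, which is not much smaller than the others. The pitch `κ` of the
spiral depends only on the number of points. -/
theorem exists_spiral_support (Ω : Type*) [Fintype Ω] :
    ∃ κ c : ℝ, 0 < κ ∧ κ ≤ 1 ∧ 0 < c ∧ ∀ u : Ω → ℂ, u ≠ 0 →
      ∃ x, u x ≠ 0 ∧ c * ‖u‖ ≤ ‖u x‖ ∧ ∀ y, (u y / u x).re + κ * (u y / u x).im ≤ 1 := by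
  rcases isEmpty_or_nonempty Ω with hΩ | hΩ
  · exact ⟨1, 1, one_pos, le_rfl, one_pos, fun u hu => absurd (Subsingleton.elim _ _) hu⟩
  set γ : ℝ := 2 * Real.pi / (Fintype.card Ω + 1) with hγ
  have hπ := Real.pi_pos
  have hγ0 : 0 < γ := by positivity
  have hγπ : γ ≤ Real.pi := by
    have : (1 : ℝ) ≤ Fintype.card Ω := by exact_mod_cast Fintype.card_pos (α := Ω)
    rw [hγ, div_le_iff₀ (by positivity)]
    nlinarith
  have hcos : Real.cos γ < 1 := by
    simpa using Real.cos_lt_cos_of_nonneg_of_le_pi le_rfl hγπ hγ0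
  obtain ⟨κ, hκ, hκ0, hκ1⟩ : ∃ κ : ℝ, Real.cos γ + κ ≤ Real.exp (-(2 * Real.pi * κ)) ∧
      0 < κ ∧ κ ≤ 1 := by
    have h1 : ∀ᶠ κ in 𝓝 (0 : ℝ), Real.cos γ + κ < Real.exp (-(2 * Real.pi * κ)) := by
      refine ContinuousAt.eventually_lt (by fun_prop) (by fun_prop) ?_
      simpa using hcos
    obtain ⟨κ, h2, h3⟩ := ((h1.filter_mono nhdsWithin_le_nhds).and
      (Ioc_mem_nhdsGT (one_pos : (0 : ℝ) < 1))).exists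
    exact ⟨κ, h2.le, h3.1, h3.2⟩
  refine ⟨κ, Real.exp (-(2 * Real.pi * κ)), hκ0, hκ1, Real.exp_pos _, fun u hu => ?_⟩
  obtain ⟨ω, hω, harg⟩ := exists_rotation_arg_le u
  set φ : Ω → ℝ := fun y => (ω * u y).arg with hφ
  obtain ⟨y₀, hy₀⟩ := Function.ne_iff.1 hu
  classical
  obtain ⟨x, hx, hmax⟩ := Finset.exists_max_image (Finset.univ.filter fun y => u y ≠ 0)
    (fun y => Real.log ‖u y‖ + κ * φ y) ⟨y₀, by simpa using hy₀⟩
  have hx0 : u x ≠ 0 := (Finset.mem_filter.1 hx).2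
  have hxn : 0 < ‖u x‖ := norm_pos_iff.2 hx0
  have hle : ∀ y, u y ≠ 0 → ‖u y‖ ≤ ‖u x‖ * Real.exp (-(κ * (φ y - φ x))) := by
    intro y hy
    have h1 := hmax y (by simpa using hy)
    have hyn : 0 < ‖u y‖ := norm_pos_iff.2 hy
    rw [← Real.log_le_log_iff hyn (by positivity), Real.log_mul hxn.ne' (Real.exp_pos _).ne',
      Real.log_exp]
    linarith
  refine ⟨x, hx0, ?_, fun y => ?_⟩
  · have h1 : ‖u‖ ≤ ‖u x‖ * Real.exp (2 * Real.pi * κ) := by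
      refine (pi_norm_le_iff_of_nonneg (by positivity)).2 fun y => ?_
      by_cases hy : u y = 0
      · simp only [hy, norm_zero]; positivity
      · refine (hle y hy).trans (mul_le_mul_of_nonneg_left (Real.exp_le_exp.2 ?_) hxn.le)
        have h2 : -Real.pi < φ y := Complex.neg_pi_lt_arg _
        have h3 : φ x ≤ Real.pi := Complex.arg_le_pi _
        nlinarith
    rw [Real.exp_neg, inv_mul_le_iff₀ (Real.exp_pos _), mul_comm]
    exact h1
  · by_cases hy : u y = 0
    · simp [hy]
    have hω0 : ω ≠ 0 := by
      rintro rfl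
      simp at hω
    have hpol : ∀ z, ω * u z = (‖u z‖ : ℂ) * Complex.exp (φ z * Complex.I) := by
      intro z
      have := Complex.norm_mul_exp_arg_mul_I (ω * u z)
      rw [norm_mul, hω, one_mul] at this
      exact this.symm
    have hw : u y / u x = ((‖u y‖ / ‖u x‖ : ℝ) : ℂ)
        * Complex.exp ((φ y - φ x : ℝ) * Complex.I) := by
      rw [← mul_div_mul_left (u y) (u x) hω0, hpol, hpol]
      push_cast
      rw [sub_mul, Complex.exp_sub]
      field_simp
    rw [hw, Complex.re_ofReal_mul, Complex.im_ofReal_mul, Complex.exp_ofReal_mul_I_re,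
      Complex.exp_ofReal_mul_I_im]
    have h1 := cos_add_mul_sin_le_exp hκ0.le hγ0.le hγπ hκ (α := φ y - φ x)
      (by have h2 : -Real.pi < φ y := Complex.neg_pi_lt_arg _
          have h3 : φ x ≤ Real.pi - γ := harg x hx0
          linarith)
    have h2 := hle y hy
    have h3 : ‖u y‖ / ‖u x‖ ≤ Real.exp (-(κ * (φ y - φ x))) := by
      rw [div_le_iff₀ hxn, mul_comm]; exact h2
    have h4 : (‖u y‖ / ‖u x‖) * Real.exp (κ * (φ y - φ x)) ≤ 1 := by
      have := mul_le_mul_of_nonneg_right h3 (Real.exp_pos (κ * (φ y - φ x))).le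
      rwa [← Real.exp_add, neg_add_cancel, Real.exp_zero] at this
    calc _ = (‖u y‖ / ‖u x‖) * (Real.cos (φ y - φ x) + κ * Real.sin (φ y - φ x)) := by ring
      _ ≤ (‖u y‖ / ‖u x‖) * Real.exp (κ * (φ y - φ x)) :=
        mul_le_mul_of_nonneg_left h1 (by positivity)
      _ ≤ 1 := h4

/-- The sectorial bound behind the convergence theorem: it holds with the same constants for all
stochastic matrices of a given size. -/
theorem exists_sectorial_bound (Ω : Type*) [Fintype Ω] [DecidableEq Ω] :
    ∃ κ K : ℝ, 0 < κ ∧ κ ≤ 1 ∧ 0 < K ∧ ∀ T ∈ Matrix.rowStochastic ℝ Ω, ∀ (z : ℂ) (u : Ω → ℂ),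
      ((z - 1).re + κ * |(z - 1).im|) * ‖u‖ ≤ K * ‖z • u - (T.map Complex.ofReal).mulVec u‖ := by
  obtain ⟨κ, c, hκ0, hκ1, hc, hsp⟩ := exists_spiral_support Ω
  have main : ∀ T ∈ Matrix.rowStochastic ℝ Ω, ∀ (z : ℂ) (u : Ω → ℂ),
      ((z - 1).re + κ * (z - 1).im) * ‖u‖
        ≤ (2 / c) * ‖z • u - (T.map Complex.ofReal).mulVec u‖ := by
    intro T hT z u
    by_cases hu : u = 0
    · subst hu; simp
    obtain ⟨x, hx0, hxc, hx⟩ := hsp u hu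
    set g := z • u - (T.map Complex.ofReal).mulVec u with hg
    set ℓ : ℂ → ℝ := fun w => w.re + κ * w.im with hℓ
    have hgx : g x = z * u x - ∑ y, (T x y : ℂ) * u y := by
      simp [hg, Matrix.mulVec, dotProduct]
    have h1 : z - 1 = g x / u x + ∑ y, (T x y : ℂ) * (u y / u x - 1) := by
      have h2 : ∑ y, (T x y : ℂ) * (u y / u x - 1) = (∑ y, (T x y : ℂ) * u y) / u x - 1 := by
        simp only [mul_sub, mul_one, Finset.sum_sub_distrib, ← mul_div_assoc, Finset.sum_div]
        rw [← Complex.ofReal_sum, Matrix.sum_row_of_mem_rowStochastic hT, Complex.ofReal_one]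
      rw [h2, hgx]
      field_simp
      ring
    have h2 : ℓ (z - 1) = ℓ (g x / u x) + ∑ y, T x y * (ℓ (u y / u x) - 1) := by
      simp only [hℓ]
      conv_lhs => rw [h1]
      simp only [Complex.add_re, Complex.add_im, Complex.re_sum, Complex.im_sum,
        Complex.re_ofReal_mul, Complex.im_ofReal_mul, Complex.sub_re, Complex.sub_im,
        Complex.one_re, Complex.one_im, Finset.mul_sum, mul_add]
      rw [add_add_add_comm, ← Finset.sum_add_distrib]
      congr 1
      exact Finset.sum_congr rfl fun y _ => by ring
    have h3 : ∑ y, T x y * (ℓ (u y / u x) - 1) ≤ 0 := Finset.sum_nonpos fun y _ =>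
      mul_nonpos_of_nonneg_of_nonpos (Matrix.nonneg_of_mem_rowStochastic hT)
        (sub_nonpos.2 (hx y))
    have h4 : ℓ (g x / u x) ≤ 2 * (‖g‖ / ‖u x‖) := by
      have h5 : ‖g x / u x‖ ≤ ‖g‖ / ‖u x‖ := by
        rw [norm_div]
        exact div_le_div_of_nonneg_right (norm_le_pi_norm g x) (norm_nonneg _)
      have h6 := Complex.re_le_norm (g x / u x)
      have h7 := (le_abs_self _).trans (Complex.abs_im_le_norm (g x / u x))
      have h8 : κ * (g x / u x).im ≤ ‖g x / u x‖ := by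
        calc κ * (g x / u x).im ≤ κ * ‖g x / u x‖ := mul_le_mul_of_nonneg_left h7 hκ0.le
          _ ≤ 1 * ‖g x / u x‖ := mul_le_mul_of_nonneg_right hκ1 (norm_nonneg _)
          _ = _ := one_mul _
      simp only [hℓ]
      linarith
    have h5 : ℓ (z - 1) * ‖u x‖ ≤ 2 * ‖g‖ := by
      have hxn : 0 < ‖u x‖ := norm_pos_iff.2 hx0
      have := mul_le_mul_of_nonneg_right (h2.le.trans (add_le_add h4 h3)) hxn.le
      rw [add_zero] at this
      calc _ ≤ _ := this
        _ = 2 * ‖g‖ := by field_simp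
    change ℓ (z - 1) * ‖u‖ ≤ _
    rcases le_total 0 (ℓ (z - 1)) with h0 | h0
    · have := mul_le_mul_of_nonneg_left hxc h0
      rw [div_mul_eq_mul_div, le_div_iff₀ hc]
      linarith
    · exact (mul_nonpos_of_nonpos_of_nonneg h0 (norm_nonneg _)).trans (by positivity)
  refine ⟨κ, 2 / c, hκ0, hκ1, by positivity, fun T hT z u => ?_⟩
  rcases abs_choice (z - 1).im with h | h
  · rw [h]; exact main T hT z u
  · -- the lower half-plane is treated by complex conjugation
    have h1 := main T hT (star z) (star u)
    have h2 : star z • star u - (T.map Complex.ofReal).mulVec (star u)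
        = star (z • u - (T.map Complex.ofReal).mulVec u) := by
      ext x
      simp [Matrix.mulVec, dotProduct]
    rw [h2, norm_star, norm_star] at h1
    rw [h]
    simpa using h1

/-! ### Recurrence classes, periods and peripheral eigenvalues -/

section Perron

variable {Ω : Type*} [Fintype Ω] [DecidableEq Ω] {S : Matrix Ω Ω ℝ}

theorem Matrix.pow_mul_apply_pos (hS : S ∈ Matrix.rowStochastic ℝ Ω) {m n : ℕ} {x y z : Ω}
    (h1 : 0 < (S ^ m) x y) (h2 : 0 < (S ^ n) y z) : 0 < (S ^ (m + n)) x z := by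
  rw [pow_add, Matrix.mul_apply]
  refine lt_of_lt_of_le (mul_pos h1 h2) (Finset.single_le_sum
    (f := fun w => (S ^ m) x w * (S ^ n) w z) (fun w _ => ?_) (Finset.mem_univ y))
  exact mul_nonneg (Matrix.nonneg_of_mem_rowStochastic (pow_mem hS m))
    (Matrix.nonneg_of_mem_rowStochastic (pow_mem hS n))

/-- Every state leads to a recurrence class, namely to the smallest set of states accessible from a
state accessible from it. -/
theorem exists_isRecurrenceClass (hS : S ∈ Matrix.rowStochastic ℝ Ω) (x : Ω) :
    ∃ C, IsRecurrenceClass S C ∧ ∃ y ∈ C, ∃ n : ℕ, 0 < (S ^ n) x y := by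
  classical
  let reach : Ω → Finset Ω := fun y => Finset.univ.filter fun z => ∃ n : ℕ, 0 < (S ^ n) y z
  have mem_reach : ∀ y z, z ∈ reach y ↔ ∃ n : ℕ, 0 < (S ^ n) y z := fun y z => by simp [reach]
  have self_mem : ∀ y, y ∈ reach y := fun y => (mem_reach y y).2 ⟨0, by simp⟩
  have trans : ∀ {y z}, z ∈ reach y → reach z ⊆ reach y := by
    intro y z hz w hw
    obtain ⟨m, hm⟩ := (mem_reach y z).1 hz
    obtain ⟨n, hn⟩ := (mem_reach z w).1 hw
    exact (mem_reach y w).2 ⟨m + n, Matrix.pow_mul_apply_pos hS hm hn⟩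
  obtain ⟨y, hy, hmin⟩ := Finset.exists_min_image (reach x) (fun y => (reach y).card)
    ⟨x, self_mem x⟩
  refine ⟨reach y, ⟨⟨y, self_mem y⟩, fun z hz w => ?_⟩, y, self_mem y, (mem_reach x y).1 hy⟩
  rw [← mem_reach z w, Finset.eq_of_subset_of_card_le (trans hz) (hmin z (trans hy hz))]

theorem IsRecurrenceClass.exists_return (hS : S ∈ Matrix.rowStochastic ℝ Ω) {C : Finset Ω}
    (hC : IsRecurrenceClass S C) : ∃ x ∈ C, ∃ n : ℕ, 0 < n ∧ 0 < (S ^ n) x x := by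
  obtain ⟨⟨x, hx⟩, hcl⟩ := hC
  obtain ⟨y, hy⟩ : ∃ y, 0 < S x y := by
    by_contra! h
    have h1 := Matrix.sum_row_of_mem_rowStochastic hS x
    linarith [Finset.sum_nonpos fun y (_ : y ∈ Finset.univ) => h y]
  have hy1 : 0 < (S ^ 1) x y := by simpa using hy
  obtain ⟨n, hn⟩ := (hcl y ((hcl x hx y).1 ⟨1, hy1⟩) x).2 hx
  exact ⟨x, hx, 1 + n, by omega, Matrix.pow_mul_apply_pos hS hy1 hn⟩

theorem IsRecurrenceClass.bddAbove (hS : S ∈ Matrix.rowStochastic ℝ Ω) {C : Finset Ω}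
    (hC : IsRecurrenceClass S C) :
    BddAbove {d : ℕ | ∀ n : ℕ, 0 < n → ∀ x ∈ C, 0 < (S ^ n) x x → d ∣ n} := by
  obtain ⟨x, hx, n, hn, hp⟩ := hC.exists_return hS
  exact ⟨n, fun d hd => Nat.le_of_dvd hn (hd n hn x hx hp)⟩

theorem IsRecurrenceClass.classPeriod_pos (hS : S ∈ Matrix.rowStochastic ℝ Ω) {C : Finset Ω}
    (hC : IsRecurrenceClass S C) : 0 < classPeriod S C :=
  le_csSup (hC.bddAbove hS) (a := 1) fun n _ _ _ _ => one_dvd n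

theorem IsRecurrenceClass.dvd_classPeriod (hS : S ∈ Matrix.rowStochastic ℝ Ω) {C : Finset Ω}
    (hC : IsRecurrenceClass S C) {d : ℕ}
    (hd : ∀ n : ℕ, 0 < n → ∀ x ∈ C, 0 < (S ^ n) x x → d ∣ n) : d ∣ classPeriod S C := by
  have hmem : classPeriod S C ∈ {d : ℕ | ∀ n : ℕ, 0 < n → ∀ x ∈ C, 0 < (S ^ n) x x → d ∣ n} :=
    Nat.sSup_mem ⟨1, fun n _ _ _ _ => one_dvd n⟩ (hC.bddAbove hS)
  have hlcm : Nat.lcm d (classPeriod S C) ∈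
      {d : ℕ | ∀ n : ℕ, 0 < n → ∀ x ∈ C, 0 < (S ^ n) x x → d ∣ n} :=
    fun n hn x hx hp => Nat.lcm_dvd (hd n hn x hx hp) (hmem n hn x hx hp)
  obtain ⟨x, hx, n, hn, hp⟩ := hC.exists_return hS
  have h2 : Nat.lcm d (classPeriod S C) = classPeriod S C :=
    le_antisymm (le_csSup (hC.bddAbove hS) hlcm)
      (Nat.le_of_dvd (Nat.pos_of_dvd_of_pos (hlcm n hn x hx hp) hn) (Nat.dvd_lcm_right d _))
  exact h2 ▸ Nat.dvd_lcm_left d _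

theorem periodProduct_pos (hS : S ∈ Matrix.rowStochastic ℝ Ω) : 0 < periodProduct S :=
  Finset.prod_pos fun C hC => IsRecurrenceClass.classPeriod_pos (C := C) hS (by simpa using hC)

theorem IsRecurrenceClass.classPeriod_dvd_periodProduct {C : Finset Ω}
    (hC : IsRecurrenceClass S C) : classPeriod S C ∣ periodProduct S := by
  unfold periodProduct
  exact Finset.dvd_prod_of_mem (fun C => classPeriod S C)
    (by simpa using hC)

/-- The equality case of the triangle inequality: where an eigenvector for an eigenvalue outside the
open unit disc has largest modulus, it is constant on the successors. -/
theorem eigenvector_eq_of_pos (hS : S ∈ Matrix.rowStochastic ℝ Ω) {α : ℂ} (hα : 1 ≤ ‖α‖)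
    {u : Ω → ℂ} (hu : (S.map Complex.ofReal).mulVec u = α • u) {x y : Ω} (hx : u x ≠ 0)
    (hmax : ∀ z, ‖u z‖ ≤ ‖u x‖) (hxy : 0 < S x y) : u y = α * u x := by
  have h1 : ∑ z, (S x z : ℂ) * u z = α * u x := by
    have := congrFun hu x
    simpa [Matrix.mulVec, dotProduct] using this
  have hαx : α * u x ≠ 0 := mul_ne_zero (norm_pos_iff.1 (by linarith)) hx
  have hle : ∀ z, ‖u z / (α * u x)‖ ≤ 1 := by
    intro z
    rw [norm_div, norm_mul, div_le_one (by rw [← norm_mul]; exact norm_pos_iff.2 hαx)]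
    nlinarith [hmax z, norm_nonneg (u x)]
  have hre : ∀ z, (u z / (α * u x)).re ≤ 1 := fun z => (Complex.re_le_norm _).trans (hle z)
  have h2 : ∑ z, S x z * (1 - (u z / (α * u x)).re) = 0 := by
    have h3 : ∑ z, (S x z : ℂ) * (u z / (α * u x)) = 1 := by
      simp only [← mul_div_assoc, ← Finset.sum_div, h1]
      exact div_self hαx
    have h4 := congrArg Complex.re h3
    simp only [Complex.re_sum, Complex.re_ofReal_mul, Complex.one_re] at h4
    simp only [mul_sub, mul_one, Finset.sum_sub_distrib, h4,
      Matrix.sum_row_of_mem_rowStochastic hS, sub_self]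
  have h3 := (Finset.sum_eq_zero_iff_of_nonneg fun z _ =>
    mul_nonneg (Matrix.nonneg_of_mem_rowStochastic hS) (sub_nonneg.2 (hre z))).1 h2 y
      (Finset.mem_univ y)
  have h4 : (u y / (α * u x)).re = 1 := by
    rcases mul_eq_zero.1 h3 with h | h
    · exact absurd h hxy.ne'
    · linarith
  have h5 : u y / (α * u x) = 1 := by
    have h6 := hle y
    have h7 : ‖u y / (α * u x)‖ ^ 2 ≤ 1 := by nlinarith [norm_nonneg (u y / (α * u x))]
    rw [← Complex.normSq_eq_norm_sq, Complex.normSq_apply, h4] at h7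
    refine Complex.ext (by simpa using h4) ?_
    have : (u y / (α * u x)).im * (u y / (α * u x)).im ≤ 0 := by linarith
    simpa using mul_self_eq_zero.1 (le_antisymm this (mul_self_nonneg _))
  exact (div_eq_one_iff_eq hαx).1 h5

theorem map_ofReal_pow (S : Matrix Ω Ω ℝ) (n : ℕ) :
    (S ^ n).map Complex.ofReal = (S.map Complex.ofReal) ^ n :=
  map_pow Complex.ofRealHom.mapMatrix S n

/-- The eigenvalues of a stochastic matrix on the unit circle are roots of unity of order dividing
the product of the periods. -/
theorem eigenvalue_pow_periodProduct (hS : S ∈ Matrix.rowStochastic ℝ Ω) {α : ℂ} (hα : 1 ≤ ‖α‖)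
    {u : Ω → ℂ} (hu0 : u ≠ 0) (hu : (S.map Complex.ofReal).mulVec u = α • u) :
    α ^ periodProduct S = 1 := by
  obtain ⟨x₀, hx₀⟩ := Function.ne_iff.1 hu0
  obtain ⟨x, -, hx⟩ := Finset.exists_max_image Finset.univ (fun x => ‖u x‖)
    ⟨x₀, Finset.mem_univ _⟩
  have hux : u x ≠ 0 := by
    intro h
    have := hx x₀ (Finset.mem_univ _)
    rw [h, norm_zero] at this
    exact hx₀ (norm_le_zero_iff.1 this)
  have hpow : ∀ n : ℕ, ((S ^ n).map Complex.ofReal).mulVec u = (α ^ n) • u := by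
    intro n
    induction n with
    | zero => simp
    | succ n ih =>
      rw [map_ofReal_pow, pow_succ, ← Matrix.mulVec_mulVec, hu, Matrix.mulVec_smul,
        ← map_ofReal_pow, ih, smul_smul, pow_succ']
  have hα' : ∀ n : ℕ, 1 ≤ ‖α ^ n‖ := fun n => by rw [norm_pow]; exact one_le_pow₀ hα
  obtain ⟨C, hC, y, hyC, n, hn⟩ := exists_isRecurrenceClass hS x
  have huy : ∀ {n : ℕ} {y : Ω}, 0 < (S ^ n) x y → u y = α ^ n * u x := fun {n y} hn =>
    eigenvector_eq_of_pos (pow_mem hS n) (hα' n) (hpow n) hux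
      (fun z => hx z (Finset.mem_univ _)) hn
  have hroot : ∀ m : ℕ, 0 < m → ∀ z ∈ C, 0 < (S ^ m) z z → orderOf α ∣ m := by
    intro m hm z hz hp
    obtain ⟨k, hk⟩ := (hC.2 y hyC z).2 hz
    have h1 := Matrix.pow_mul_apply_pos hS hn hk
    have h2 := Matrix.pow_mul_apply_pos hS h1 hp
    have h3 := (huy h1).symm.trans (huy h2)
    rw [pow_add _ _ m, mul_right_comm] at h3
    have h4 : α ^ (n + k) * u x ≠ 0 :=
      mul_ne_zero (norm_pos_iff.1 (by linarith [hα' (n + k)])) hux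
    exact orderOf_dvd_of_pow_eq_one (mul_left_cancel₀ h4 (by rw [mul_one]; exact h3.symm))
  exact orderOf_dvd_iff_pow_eq_one.1
    ((hC.dvd_classPeriod hS hroot).trans hC.classPeriod_dvd_periodProduct)

theorem mulVec_injective_of_one_le_norm (hS : S ∈ Matrix.rowStochastic ℝ Ω) {z : ℂ}
    (hz : 1 ≤ ‖z‖) (hz1 : z ≠ 1) {u : Ω → ℂ}
    (hu : z • u - ((S ^ periodProduct S).map Complex.ofReal).mulVec u = 0) : u = 0 := by
  by_contra hu0
  set B := S.map Complex.ofReal with hB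
  have h1 : z ∈ spectrum ℂ (B ^ periodProduct S) := by
    rw [← Matrix.spectrum_toLin', ← Module.End.hasEigenvalue_iff_mem_spectrum]
    refine Module.End.hasEigenvalue_of_hasEigenvector (x := u)
      ⟨Module.End.mem_eigenspace_iff.2 ?_, hu0⟩
    rw [Matrix.toLin'_apply, ← map_ofReal_pow]
    exact (sub_eq_zero.1 hu).symm
  rw [spectrum.map_pow_of_pos _ (periodProduct_pos hS)] at h1
  obtain ⟨α, hα, rfl⟩ := h1
  rw [← Matrix.spectrum_toLin', ← Module.End.hasEigenvalue_iff_mem_spectrum] at hα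
  obtain ⟨v, hv⟩ := hα.exists_hasEigenvector
  refine hz1 (eigenvalue_pow_periodProduct hS ?_ hv.2 (u := v) ?_)
  · by_contra! h
    have : ‖α ^ periodProduct S‖ < 1 := by
      rw [norm_pow]; exact pow_lt_one₀ (norm_nonneg _) h (periodProduct_pos hS).ne'
    exact absurd hz (not_le.2 this)
  · have := Module.End.mem_eigenspace_iff.1 hv.1
    rwa [Matrix.toLin'_apply] at this

/-- All stochastic matrices near `S ^ N`, where `N` is the product of the periods of `S`, satisfy
the same resolvent bound of Ritt type. Near `1` this is the sectorial bound; elsewhere it follows by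
compactness, since `1` is the only eigenvalue of `S ^ N` on the unit circle. -/
theorem exists_ritt_bound (hS : S ∈ Matrix.rowStochastic ℝ Ω) :
    ∃ C : ℝ, 0 < C ∧ ∀ᶠ T in 𝓝 (S ^ periodProduct S), T ∈ Matrix.rowStochastic ℝ Ω →
      ∀ z : ℂ, 1 ≤ ‖z‖ → ‖z‖ ≤ 3 → ∀ u : Ω → ℂ,
        ‖z - 1‖ * ‖u‖ ≤ C * ‖z • u - (T.map Complex.ofReal).mulVec u‖ := by
  obtain ⟨κ, K, hκ0, hκ1, hK, hsec⟩ := exists_sectorial_bound Ω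
  set T₀ := S ^ periodProduct S with hT₀
  set δ : ℝ := κ / 2 with hδ
  have hδ0 : 0 < δ := by positivity
  -- a lower bound away from `1`
  obtain ⟨a, ha0, ha⟩ : ∃ a : ℝ, 0 < a ∧ ∀ p ∈ ({z : ℂ | 1 ≤ ‖z‖ ∧ ‖z‖ ≤ 3 ∧ δ ≤ ‖z - 1‖} ×ˢ
      Metric.sphere (0 : Ω → ℂ) 1), a ≤ ‖p.1 • p.2 - (T₀.map Complex.ofReal).mulVec p.2‖ := by
    have hcl : IsClosed {z : ℂ | 1 ≤ ‖z‖ ∧ ‖z‖ ≤ 3 ∧ δ ≤ ‖z - 1‖} := by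
      exact (isClosed_le continuous_const continuous_norm).inter
        ((isClosed_le continuous_norm continuous_const).inter
          (isClosed_le continuous_const (continuous_id.sub continuous_const).norm))
    have hcpt : IsCompact {z : ℂ | 1 ≤ ‖z‖ ∧ ‖z‖ ≤ 3 ∧ δ ≤ ‖z - 1‖} :=
      (isCompact_closedBall (0 : ℂ) 3).of_isClosed_subset hcl fun z hz => by
        simpa using hz.2.1
    refine (hcpt.prod (isCompact_sphere _ _)).exists_forall_le' ?_ ?_
    · refine Continuous.continuousOn (continuous_norm.comp ((by fun_prop :
        Continuous fun p : ℂ × (Ω → ℂ) => p.1 • p.2).sub ?_))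
      exact Continuous.matrix_mulVec continuous_const continuous_snd
    · rintro ⟨z, u⟩ ⟨⟨hz1, -, hz2⟩, hu⟩
      rw [norm_pos_iff]
      intro h
      have hzne : z ≠ 1 := by rintro rfl; simp at hz2; linarith
      have := mulVec_injective_of_one_le_norm hS hz1 hzne h
      rw [mem_sphere_iff_norm, sub_zero] at hu
      dsimp only at hu this
      rw [this, norm_zero] at hu
      exact zero_ne_one hu
  refine ⟨4 * K / κ + 8 / a, by positivity, ?_⟩
  have hnear : ∀ᶠ T : Matrix Ω Ω ℝ in 𝓝 T₀, ∑ x, ∑ y, |T x y - T₀ x y| < a / 2 := by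
    refine ContinuousAt.eventually_lt ?_ continuousAt_const (by simpa using ha0)
    refine Continuous.continuousAt (continuous_finsetSum _ fun x _ =>
      continuous_finsetSum _ fun y _ => ?_)
    exact ((continuous_id.matrix_elem x y).sub continuous_const).abs
  filter_upwards [hnear] with T hTn hT z hz1 hz3 u
  set g := z • u - (T.map Complex.ofReal).mulVec u with hg
  have hKκ : 0 ≤ K / κ := by positivity
  rcases le_total ‖z - 1‖ δ with hle | hge
  · have h1 := hsec T hT z u
    set s := z - 1 with hs
    -- `1 ≤ ‖1 + s‖` keeps `s` in the sector where the sectorial bound is effective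
    have h2 : κ / 4 * ‖s‖ ≤ s.re + κ * |s.im| := by
      have h3 : 0 ≤ 2 * s.re + ‖s‖ ^ 2 := by
        have h4 : 1 ≤ ‖z‖ ^ 2 := one_le_pow₀ hz1
        have h5 : z = 1 + s := by rw [hs]; ring
        rw [h5, ← Complex.normSq_eq_norm_sq, Complex.normSq_apply] at h4
        rw [← Complex.normSq_eq_norm_sq, Complex.normSq_apply]
        simp only [Complex.add_re, Complex.add_im, Complex.one_re, Complex.one_im] at h4
        nlinarith
      have h6 := Complex.norm_le_abs_re_add_abs_im s
      have h8 := norm_nonneg s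
      rcases le_total 0 s.re with h7 | h7
      · rw [abs_of_nonneg h7] at h6
        nlinarith [abs_nonneg s.im]
      · rw [abs_of_nonpos h7] at h6
        nlinarith [abs_nonneg s.im]
    have h3 := (mul_le_mul_of_nonneg_right h2 (norm_nonneg u)).trans h1
    have h4 : ‖s‖ * ‖u‖ ≤ 4 * K / κ * ‖g‖ := by
      rw [div_mul_eq_mul_div, le_div_iff₀ hκ0]
      linarith
    have h5 : 0 ≤ 8 / a * ‖g‖ := by positivity
    linarith
  · have h1 : a * ‖u‖ ≤ ‖z • u - (T₀.map Complex.ofReal).mulVec u‖ := by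
      by_cases hu : u = 0
      · subst hu; simp
      have hun : 0 < ‖u‖ := norm_pos_iff.2 hu
      have h2 := ha (z, ((‖u‖⁻¹ : ℝ) : ℂ) • u) ⟨⟨hz1, hz3, hge⟩, by
        rw [mem_sphere_iff_norm, sub_zero, norm_smul, Complex.norm_real, Real.norm_eq_abs,
          abs_of_pos (inv_pos.2 hun), inv_mul_cancel₀ hun.ne']⟩
      simp only [Matrix.mulVec_smul] at h2
      rw [smul_comm, ← smul_sub, norm_smul, Complex.norm_real, Real.norm_eq_abs,
        abs_of_pos (inv_pos.2 hun), inv_mul_eq_div, le_div_iff₀ hun] at h2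
      exact h2
    have h2 : ‖(T.map Complex.ofReal).mulVec u - (T₀.map Complex.ofReal).mulVec u‖
        ≤ a / 2 * ‖u‖ := by
      refine (pi_norm_le_iff_of_nonneg (by positivity)).2 fun x => ?_
      have h3 : ((T.map Complex.ofReal).mulVec u - (T₀.map Complex.ofReal).mulVec u) x
          = ∑ y, ((T x y - T₀ x y : ℝ) : ℂ) * u y := by
        simp [Matrix.mulVec, dotProduct, sub_mul]
      rw [h3]
      calc _ ≤ ∑ y, ‖((T x y - T₀ x y : ℝ) : ℂ) * u y‖ := norm_sum_le _ _
        _ ≤ ∑ y, |T x y - T₀ x y| * ‖u‖ := Finset.sum_le_sum fun y _ => by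
          rw [norm_mul, Complex.norm_real, Real.norm_eq_abs]
          exact mul_le_mul_of_nonneg_left (norm_le_pi_norm u y) (abs_nonneg _)
        _ = (∑ y, |T x y - T₀ x y|) * ‖u‖ := by rw [Finset.sum_mul]
        _ ≤ a / 2 * ‖u‖ := by
          refine mul_le_mul_of_nonneg_right (le_trans ?_ hTn.le) (norm_nonneg _)
          exact Finset.single_le_sum (f := fun x => ∑ y, |T x y - T₀ x y|)
            (fun x _ => Finset.sum_nonneg fun y _ => abs_nonneg _) (Finset.mem_univ x)
    have h3 : ‖z • u - (T₀.map Complex.ofReal).mulVec u‖ ≤ ‖g‖ +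
        ‖(T.map Complex.ofReal).mulVec u - (T₀.map Complex.ofReal).mulVec u‖ := by
      refine le_trans (le_of_eq ?_) (norm_add_le _ _)
      rw [hg, sub_add_sub_cancel]
    have h4 : a / 2 * ‖u‖ ≤ ‖g‖ := by linarith
    have h5 : ‖z - 1‖ ≤ 4 := (norm_sub_le _ _).trans (by rw [norm_one]; linarith)
    have h6 : ‖z - 1‖ * ‖u‖ ≤ 8 / a * ‖g‖ := by
      rw [div_mul_eq_mul_div, le_div_iff₀ ha0]
      have h7 := mul_le_mul_of_nonneg_right h5 (norm_nonneg u)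
      have h8 := mul_le_mul_of_nonneg_right h7 ha0.le
      linarith
    have h7 : 0 ≤ 4 * K / κ * ‖g‖ := by positivity
    linarith

end Perron

/-! ### Powers as contour integrals of the resolvent -/

theorem norm_pow_le_one_of_norm_le_one {A : Type*} [NormedRing A] {a : A}
    (h1 : ‖(1 : A)‖ ≤ 1) (ha : ‖a‖ ≤ 1) (n : ℕ) : ‖a ^ n‖ ≤ 1 := by
  induction n with
  | zero => simpa using h1
  | succ n ih => exact (pow_succ a n ▸ norm_mul_le _ _).trans (mul_le_one₀ ih (norm_nonneg _) ha)

theorem smul_resolvent_eq {A : Type*} [Ring A] [Algebra ℂ A] {a : A} {z : ℂ}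
    (hz : z ∈ resolventSet ℂ a) :
    z • resolvent a z = 1 + a * resolvent a z := by
  have h : (algebraMap ℂ A z - a) * resolvent a z = 1 := Ring.mul_inverse_cancel _ hz
  rw [sub_mul, sub_eq_iff_eq_add, ← Algebra.smul_def] at h
  exact h

section CauchyIntegral

open MeasureTheory

variable {A : Type*} [NormedRing A] [NormedAlgebra ℂ A] [CompleteSpace A] {a : A}

theorem mem_resolventSet_of_one_lt_norm (h1 : ‖(1 : A)‖ ≤ 1) (ha : ‖a‖ ≤ 1) {z : ℂ}
    (hz : 1 < ‖z‖) : z ∈ resolventSet ℂ a :=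
  spectrum.mem_resolventSet_of_norm_lt_mul
    (lt_of_le_of_lt (mul_le_one₀ ha (norm_nonneg _) h1) hz)

theorem continuousAt_resolvent {z : ℂ} (hz : z ∈ resolventSet ℂ a) :
    ContinuousAt (resolvent a) z :=
  (spectrum.hasDerivAt_resolvent_const_left hz).continuousAt

theorem ne_zero_of_mem_circle {r : ℝ} (hr : 0 < r) {z : ℂ} (hz : z ∈ Metric.sphere (0 : ℂ) r) :
    z ≠ 0 := by
  rintro rfl
  simp at hz
  exact hr.ne hz

theorem circleIntegrable_zpow_smul_resolvent (h1 : ‖(1 : A)‖ ≤ 1) (ha : ‖a‖ ≤ 1) {r : ℝ}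
    (hr : 1 < r) (n : ℤ) : CircleIntegrable (fun z : ℂ => z ^ n • resolvent a z) 0 r := by
  refine ContinuousOn.circleIntegrable (by linarith) fun z hz => ?_
  have hz0 := ne_zero_of_mem_circle (by linarith) hz
  refine ContinuousAt.continuousWithinAt ((continuousAt_zpow₀ z n (Or.inl hz0)).smul
    (continuousAt_resolvent (mem_resolventSet_of_one_lt_norm h1 ha ?_)))
  rw [mem_sphere_zero_iff_norm.1 hz]
  exact hr

/-- The recursion satisfied by the moments of the resolvent, from `z R(z) = 1 + a R(z)`. -/
theorem circleIntegral_zpow_succ_smul_resolvent (h1 : ‖(1 : A)‖ ≤ 1) (ha : ‖a‖ ≤ 1) {r : ℝ}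
    (hr : 1 < r) (n : ℤ) :
    (∮ z in C(0, r), z ^ (n + 1) • resolvent a z)
      = (∮ z in C(0, r), z ^ n) • (1 : A) + a * ∮ z in C(0, r), z ^ n • resolvent a z := by
  have hr0 : (0 : ℝ) ≤ r := by linarith
  have hI := circleIntegrable_zpow_smul_resolvent h1 ha hr n
  have e1 : a * ∮ z in C(0, r), z ^ n • resolvent a z
      = ∮ z in C(0, r), a * (z ^ n • resolvent a z) := by
    have := ((ContinuousLinearMap.mul ℂ A) a).intervalIntegral_comp_comm hI.out
    simp only [ContinuousLinearMap.mul_apply', mul_smul_comm] at this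
    simp only [circleIntegral, mul_smul_comm]
    exact this.symm
  have hc1 : CircleIntegrable (fun z : ℂ => z ^ n • (1 : A)) 0 r := by
    refine ContinuousOn.circleIntegrable hr0 fun z hz => ?_
    have hz0 := ne_zero_of_mem_circle (by linarith) hz
    exact ((continuousAt_zpow₀ z n (Or.inl hz0)).smul continuousAt_const).continuousWithinAt
  have hc2 : CircleIntegrable (fun z : ℂ => a * (z ^ n • resolvent a z)) 0 r := by
    refine ContinuousOn.circleIntegrable hr0 fun z hz => ?_
    have hz0 := ne_zero_of_mem_circle (by linarith) hz
    refine (continuousAt_const.mul ((continuousAt_zpow₀ z n (Or.inl hz0)).smul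
      (continuousAt_resolvent (mem_resolventSet_of_one_lt_norm h1 ha ?_)))).continuousWithinAt
    rw [mem_sphere_zero_iff_norm.1 hz]
    exact hr
  rw [e1, ← circleIntegral.integral_smul_const, ← circleIntegral.integral_add hc1 hc2]
  refine circleIntegral.integral_congr hr0 fun z hz => ?_
  have hz0 := ne_zero_of_mem_circle (by linarith) hz
  have hz1 : 1 < ‖z‖ := by rw [mem_sphere_zero_iff_norm.1 hz]; exact hr
  rw [zpow_add_one₀ hz0, mul_smul, smul_resolvent_eq (mem_resolventSet_of_one_lt_norm h1 ha hz1),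
    smul_add, mul_smul_comm]

theorem circleIntegral_pow_smul_resolvent (h1 : ‖(1 : A)‖ ≤ 1) (ha : ‖a‖ ≤ 1) {r : ℝ}
    (hr : 1 < r) (k : ℕ) :
    (∮ z in C(0, r), z ^ k • resolvent a z) = (2 * Real.pi * Complex.I : ℂ) • a ^ k := by
  have hzero : ∀ n : ℤ, n ≠ -1 → (∮ z in C(0, r), z ^ n) = 0 := fun n hn => by
    simpa using circleIntegral.integral_sub_zpow_of_ne hn 0 0 r
  set J : ℤ → A := fun n => ∮ z in C(0, r), z ^ n • resolvent a z with hJ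
  have hrec : ∀ n : ℤ, n ≠ -1 → J (n + 1) = a * J n := fun n hn => by
    simp only [hJ]
    rw [circleIntegral_zpow_succ_smul_resolvent h1 ha hr, hzero n hn, zero_smul, zero_add]
  -- the moments of negative order vanish: moving far to the left shows that they are small
  have hneg : J (-1) = 0 := by
    have h2 : ∀ m : ℕ, J (-1) = a ^ m * J (-1 - m) := by
      intro m
      induction m with
      | zero => simp
      | succ m ih =>
        rw [ih, pow_succ, mul_assoc, ← hrec _ (by push_cast; omega)]
        congr 2
        push_cast
        ring
    obtain ⟨B, hB⟩ := (isCompact_sphere (0 : ℂ) r).exists_bound_of_continuousOn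
      (f := resolvent a) fun z hz => (continuousAt_resolvent (mem_resolventSet_of_one_lt_norm h1 ha
        (by rw [mem_sphere_zero_iff_norm.1 hz]; exact hr))).continuousWithinAt
    have hr0 : 0 < r := by linarith
    have h3 : ∀ m : ℕ, ‖J (-1)‖ ≤ 2 * Real.pi * r * (r⁻¹ ^ (m + 1) * B) := by
      intro m
      rw [h2 m]
      refine (norm_mul_le _ _).trans ((mul_le_of_le_one_left (norm_nonneg _)
        (norm_pow_le_one_of_norm_le_one h1 ha m)).trans ?_)
      refine circleIntegral.norm_integral_le_of_norm_le_const hr0.le fun z hz => ?_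
      rw [norm_smul, norm_zpow, mem_sphere_zero_iff_norm.1 hz]
      have e : r ^ (-1 - (m : ℤ)) = r⁻¹ ^ (m + 1) := by
        rw [inv_pow, ← zpow_natCast, ← zpow_neg]
        congr 1
        push_cast
        ring
      rw [e]
      exact mul_le_mul_of_nonneg_left (hB z hz) (by positivity)
    have h4 : Tendsto (fun m : ℕ => 2 * Real.pi * r * (r⁻¹ ^ (m + 1) * B)) atTop (𝓝 0) := by
      have h5 := ((tendsto_pow_atTop_nhds_zero_of_lt_one (inv_nonneg.2 hr0.le)
        (inv_lt_one_of_one_lt₀ hr)).comp (tendsto_add_atTop_nat 1)).mul_const B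
      simpa using h5.const_mul (2 * Real.pi * r)
    exact norm_le_zero_iff.1 (ge_of_tendsto' h4 h3)
  have h0 : J 0 = (2 * Real.pi * Complex.I : ℂ) • (1 : A) := by
    have h2 := circleIntegral_zpow_succ_smul_resolvent h1 ha hr (-1)
    have h3 : (∮ z in C(0, r), z ^ (-1 : ℤ)) = 2 * Real.pi * Complex.I := by
      simpa using circleIntegral.integral_sub_center_inv 0 (R := r) (by linarith)
    rw [h3, show (∮ z in C(0, r), z ^ (-1 : ℤ) • resolvent a z) = 0 from hneg, mul_zero,
      add_zero] at h2
    exact h2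
  have hk : ∀ k : ℕ, J k = (2 * Real.pi * Complex.I : ℂ) • a ^ k := by
    intro k
    induction k with
    | zero => simpa using h0
    | succ k ih =>
      rw [Nat.cast_succ, hrec _ (by omega), ih, mul_smul_comm, ← pow_succ']
  simpa [hJ] using hk k

/-- Cauchy's formula for the powers of `a`, with the square of the resolvent, which decays fast
enough to be integrated over a long circle. -/
theorem circleIntegral_pow_smul_resolvent_sq (h1 : ‖(1 : A)‖ ≤ 1) (ha : ‖a‖ ≤ 1) {r : ℝ}
    (hr : 1 < r) (k : ℕ) :
    (∮ z in C(0, r), z ^ (k + 1) • resolvent a z ^ 2)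
      = (2 * Real.pi * Complex.I * (k + 1) : ℂ) • a ^ k := by
  have hr0 : (0 : ℝ) ≤ r := by linarith
  have hmem : ∀ z ∈ Metric.sphere (0 : ℂ) r, z ∈ resolventSet ℂ a := fun z hz =>
    mem_resolventSet_of_one_lt_norm h1 ha (by rw [mem_sphere_zero_iff_norm.1 hz]; exact hr)
  have h2 : (∮ z in C(0, r), (((k + 1 : ℕ) : ℂ) • (z ^ k • resolvent a z)
      - z ^ (k + 1) • resolvent a z ^ 2)) = 0 := by
    refine circleIntegral.integral_eq_zero_of_hasDerivWithinAt hr0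
      (f := fun z => z ^ (k + 1) • resolvent a z) fun z hz => ?_
    have := (hasDerivAt_pow (k + 1) z).smul
      (spectrum.hasDerivAt_resolvent_const_left (hmem z hz))
    refine (this.congr_deriv ?_).hasDerivWithinAt
    rw [smul_neg, mul_smul, Nat.add_sub_cancel]
    abel
  have hc1 : CircleIntegrable (fun z : ℂ => ((k + 1 : ℕ) : ℂ) • (z ^ k • resolvent a z)) 0 r :=
    ContinuousOn.circleIntegrable hr0 fun z hz => (continuousAt_const.smul
      ((continuousAt_id.pow k).smul (continuousAt_resolvent (hmem z hz)))).continuousWithinAt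
  have hc2 : CircleIntegrable (fun z : ℂ => z ^ (k + 1) • resolvent a z ^ 2) 0 r :=
    ContinuousOn.circleIntegrable hr0 fun z hz => ((continuousAt_id.pow (k + 1)).smul
      ((continuousAt_resolvent (hmem z hz)).pow 2)).continuousWithinAt
  rw [circleIntegral.integral_sub hc1 hc2, circleIntegral.integral_smul,
    circleIntegral_pow_smul_resolvent h1 ha hr, sub_eq_zero] at h2
  rw [← h2, smul_smul]
  congr 1
  push_cast
  ring

/-- The integrand of Cauchy's formula on the circle of radius `exp (1 / k)`, in the rescaled
angle `y`. -/
noncomputable def cauchyIntegrand (a : A) (k : ℕ) (y : ℝ) : A :=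
  ((k / (k + 1) : ℂ) * Complex.exp ((1 + y * Complex.I) / k) ^ (k + 2)) •
    ((k : ℂ)⁻¹ • resolvent a (Complex.exp ((1 + y * Complex.I) / k))) ^ 2

theorem norm_exp_div (k : ℕ) (y : ℝ) :
    ‖Complex.exp ((1 + y * Complex.I) / k)‖ = Real.exp (1 / k) := by
  rw [Complex.norm_exp]
  congr 1
  have : (1 + y * Complex.I) / (k : ℂ) = ((1 / k : ℝ) : ℂ) + ((y / k : ℝ) : ℂ) * Complex.I := by
    push_cast; ring
  rw [this]
  simp

theorem one_lt_norm_exp_div {k : ℕ} (hk : 0 < k) (y : ℝ) :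
    1 < ‖Complex.exp ((1 + y * Complex.I) / k)‖ := by
  rw [norm_exp_div]
  exact Real.one_lt_exp_iff.2 (by positivity)

theorem pow_eq_integral_cauchyIntegrand (h1 : ‖(1 : A)‖ ≤ 1) (ha : ‖a‖ ≤ 1) {k : ℕ}
    (hk : 0 < k) :
    a ^ k = ((2 * Real.pi)⁻¹ : ℝ) •
      ∫ y, Set.indicator (Set.Ioc (-(Real.pi * k)) (Real.pi * k)) (cauchyIntegrand a k) y := by
  have hk0 : (0 : ℝ) < k := by exact_mod_cast hk
  have hkc : (k : ℂ) ≠ 0 := by exact_mod_cast hk.ne'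
  set r := Real.exp (1 / k) with hr
  have hr1 : 1 < r := Real.one_lt_exp_iff.2 (by positivity)
  set f : ℝ → A := fun θ => circleMap 0 r θ ^ (k + 2) • resolvent a (circleMap 0 r θ) ^ 2 with hf
  have hcirc : (∮ z in C(0, r), z ^ (k + 1) • resolvent a z ^ 2)
      = Complex.I • ∫ θ in -Real.pi..Real.pi, f θ := by
    have hper : Function.Periodic f (2 * Real.pi) := fun θ => by
      simp only [hf, periodic_circleMap 0 r θ]
    have h2 := hper.intervalIntegral_add_eq 0 (-Real.pi)
    rw [zero_add, show -Real.pi + 2 * Real.pi = Real.pi by ring] at h2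
    rw [← h2, ← intervalIntegral.integral_smul, circleIntegral]
    congr 1
    ext θ
    rw [deriv_circleMap, hf, smul_smul, smul_smul]
    congr 1
    ring
  have hpoint : ∀ y : ℝ, f (y / k) = (k * (k + 1) : ℂ) • cauchyIntegrand a k y := by
    intro y
    have e : circleMap 0 r (y / k) = Complex.exp ((1 + y * Complex.I) / k) := by
      rw [circleMap, zero_add, hr, Complex.ofReal_exp, ← Complex.exp_add]
      congr 1
      push_cast
      ring
    have hk1 : (k : ℂ) + 1 ≠ 0 := by exact_mod_cast k.succ_ne_zero
    simp only [hf, cauchyIntegrand, e, smul_pow, smul_smul]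
    congr 1
    field_simp
  have hscale : ∫ θ in -Real.pi..Real.pi, f θ
      = (k + 1 : ℂ) • ∫ y in -(Real.pi * k)..(Real.pi * k), cauchyIntegrand a k y := by
    have h2 := intervalIntegral.integral_comp_div (a := -(Real.pi * k)) (b := Real.pi * k) f hk0.ne'
    rw [neg_div, mul_div_cancel_right₀ _ hk0.ne'] at h2
    simp only [hpoint] at h2
    rw [intervalIntegral.integral_smul, mul_smul, ← Complex.coe_smul, Complex.ofReal_natCast] at h2
    exact (smul_right_injective A hkc h2).symm
  rw [circleIntegral_pow_smul_resolvent_sq h1 ha hr1, hscale] at hcirc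
  rw [integral_indicator measurableSet_Ioc,
    ← intervalIntegral.integral_of_le (by nlinarith [Real.pi_pos])]
  have hk1 : (k : ℂ) + 1 ≠ 0 := by exact_mod_cast k.succ_ne_zero
  have hπ : (Real.pi : ℂ) ≠ 0 := by exact_mod_cast Real.pi_ne_zero
  have hc : (Complex.I * (k + 1) * (2 * Real.pi) : ℂ) ≠ 0 := by simp [hk1, hπ]
  apply smul_right_injective A hc
  simp only
  rw [smul_smul] at hcirc
  rw [← Complex.coe_smul, smul_smul]
  refine Eq.trans ?_ (hcirc.trans ?_)
  · congr 1; ring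
  · congr 1
    push_cast
    field_simp

theorem continuous_cauchyIntegrand (h1 : ‖(1 : A)‖ ≤ 1) (ha : ‖a‖ ≤ 1) {k : ℕ} (hk : 0 < k) :
    Continuous (cauchyIntegrand a k) := by
  have hz : Continuous fun y : ℝ => Complex.exp ((1 + y * Complex.I) / k) := by fun_prop
  refine (continuous_const.mul (hz.pow _)).smul (Continuous.pow (Continuous.const_smul
    (continuous_iff_continuousAt.2 fun y => ?_) _) 2)
  exact (continuousAt_resolvent (mem_resolventSet_of_one_lt_norm h1 ha
    (one_lt_norm_exp_div hk y))).comp (f := fun y : ℝ => Complex.exp ((1 + y * Complex.I) / k))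
      hz.continuousAt

/-- On the circle of radius `exp (1 / k)`, the distance to `1` is at least comparable with
`(1 + |y|) / k`, where `y / k` is the angle. -/
theorem one_add_sq_le_norm_exp_sub_one {k : ℕ} (hk : 0 < k) {y : ℝ} (hy : |y| ≤ Real.pi * k) :
    1 + y ^ 2 ≤ 6 * (k * ‖Complex.exp ((1 + y * Complex.I) / k) - 1‖) ^ 2 := by
  have hk0 : (0 : ℝ) < k := by exact_mod_cast hk
  set z := Complex.exp ((1 + y * Complex.I) / k) with hz
  have h1 : 1 ≤ k * ‖z - 1‖ := by
    have h2 : Real.exp (1 / k) - 1 ≤ ‖z - 1‖ := by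
      rw [← norm_exp_div k y]
      simpa using norm_sub_norm_le z 1
    have h3 := Real.add_one_le_exp (1 / (k : ℝ))
    have h4 : 1 / (k : ℝ) ≤ ‖z - 1‖ := by linarith
    rwa [div_le_iff₀ hk0, mul_comm] at h4
  have h2 : 2 / Real.pi * |y| ≤ k * ‖z - 1‖ := by
    set θ := y / k with hθ
    have e : z = (Real.exp (1 / k) : ℂ) * Complex.exp (Complex.I * θ) := by
      rw [hz, Complex.ofReal_exp, ← Complex.exp_add]
      congr 1
      rw [hθ]
      push_cast
      ring
    have h3 : ‖Complex.exp (Complex.I * θ) - 1‖ ≤ ‖z - 1‖ := by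
      have hr : 1 ≤ Real.exp (1 / k) := Real.one_le_exp (by positivity)
      rw [e, mul_comm Complex.I]
      generalize Real.exp (1 / k) = r at hr
      refine le_of_sq_le_sq ?_ (norm_nonneg _)
      rw [← Complex.normSq_eq_norm_sq, ← Complex.normSq_eq_norm_sq, Complex.normSq_apply,
        Complex.normSq_apply]
      simp only [Complex.sub_re, Complex.sub_im, Complex.one_re, Complex.one_im,
        Complex.re_ofReal_mul, Complex.im_ofReal_mul, Complex.exp_ofReal_mul_I_re,
        Complex.exp_ofReal_mul_I_im]
      have h5 : (r - 1) * (r + 1 - 2 * Real.cos θ) ≥ 0 :=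
        mul_nonneg (by linarith) (by linarith [Real.cos_le_one θ])
      linear_combination h5 + (1 - r ^ 2) * Real.sin_sq_add_cos_sq θ
    have hθπ : |θ / 2| ≤ Real.pi / 2 := by
      rw [abs_div, hθ, abs_div, abs_of_pos hk0, abs_of_pos (two_pos : (0 : ℝ) < 2)]
      have : |y| / k ≤ Real.pi := by rwa [div_le_iff₀ hk0]
      linarith
    have h4 := Real.mul_abs_le_abs_sin hθπ
    rw [Complex.norm_exp_I_mul_ofReal_sub_one, Real.norm_eq_abs, abs_mul,
      abs_of_pos (two_pos : (0 : ℝ) < 2)] at h3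
    rw [abs_div, abs_of_pos (two_pos : (0 : ℝ) < 2), hθ, abs_div, abs_of_pos hk0] at h4
    have h5 : 2 / Real.pi * |y| = k * (2 * (2 / Real.pi * (|y| / k / 2))) := by field_simp
    rw [h5]
    exact mul_le_mul_of_nonneg_left (by linarith) hk0.le
  have hπ := Real.pi_pos
  have h3 : |y| ≤ 2 * (k * ‖z - 1‖) := by
    have h4 : |y| * 2 ≤ (k * ‖z - 1‖) * Real.pi := by
      rwa [div_mul_eq_mul_div, div_le_iff₀ hπ, mul_comm 2] at h2
    nlinarith [Real.pi_le_four]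
  nlinarith [sq_abs y, abs_nonneg y]

theorem norm_cauchyIntegrand_le {A : Type*} [NormedRing A] [NormedAlgebra ℂ A] {a : A} {k : ℕ}
    (hk : 0 < k) {C : ℝ}
    (hC : ∀ z : ℂ, 1 < ‖z‖ → ‖z‖ ≤ 3 → ‖z - 1‖ * ‖resolvent a z‖ ≤ C) {y : ℝ}
    (hy : |y| ≤ Real.pi * k) :
    ‖cauchyIntegrand a k y‖ ≤ 6 * Real.exp 3 * C ^ 2 * (1 + y ^ 2)⁻¹ := by
  have hk0 : (0 : ℝ) < k := by exact_mod_cast hk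
  have hk1 : (1 : ℝ) ≤ k := by exact_mod_cast hk
  set z := Complex.exp ((1 + y * Complex.I) / k) with hz
  have hz3 : ‖z‖ ≤ 3 := by
    rw [norm_exp_div]
    have : 1 / (k : ℝ) ≤ 1 := by rw [div_le_one hk0]; exact hk1
    exact (Real.exp_le_exp.2 this).trans (by linarith [Real.exp_one_lt_d9])
  have h1 := hC z (one_lt_norm_exp_div hk y) hz3
  have h2 := one_add_sq_le_norm_exp_sub_one hk hy
  rw [← hz] at h2
  have h3 : ‖(k : ℂ)⁻¹ • resolvent a z‖ = (k : ℝ)⁻¹ * ‖resolvent a z‖ := by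
    rw [norm_smul, norm_inv, Complex.norm_natCast]
  have h4 : ‖((k / (k + 1) : ℂ) * z ^ (k + 2))‖ ≤ Real.exp 3 := by
    rw [norm_mul, norm_pow, norm_exp_div, ← Real.exp_nat_mul, norm_div, Complex.norm_natCast]
    have e1 : ‖(k + 1 : ℂ)‖ = k + 1 := by
      rw [show (k + 1 : ℂ) = ((k + 1 : ℕ) : ℂ) by push_cast; rfl, Complex.norm_natCast]
      push_cast; rfl
    rw [e1]
    have e2 : (k : ℝ) / (k + 1) ≤ 1 := by rw [div_le_one (by positivity)]; linarith
    have e3 : ((k + 2 : ℕ) : ℝ) * (1 / k) ≤ 3 := by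
      rw [mul_one_div, div_le_iff₀ hk0]; push_cast; linarith
    calc _ ≤ 1 * Real.exp 3 :=
          mul_le_mul e2 (Real.exp_le_exp.2 e3) (Real.exp_pos _).le zero_le_one
      _ = _ := one_mul _
  have h5 : ‖((k : ℂ)⁻¹ • resolvent a z) ^ 2‖ ≤ 6 * C ^ 2 * (1 + y ^ 2)⁻¹ := by
    refine (norm_pow_le' _ two_pos).trans ?_
    rw [h3, ← div_eq_mul_inv, le_div_iff₀ (by positivity)]
    have h6 : ((k : ℝ)⁻¹ * ‖resolvent a z‖) * (k * ‖z - 1‖) ≤ C := by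
      calc _ = ‖z - 1‖ * ‖resolvent a z‖ := by field_simp
        _ ≤ C := h1
    have h7 : (((k : ℝ)⁻¹ * ‖resolvent a z‖) * (k * ‖z - 1‖)) ^ 2 ≤ C ^ 2 :=
      pow_le_pow_left₀ (by positivity) h6 2
    calc _ ≤ ((k : ℝ)⁻¹ * ‖resolvent a z‖) ^ 2 * (6 * (k * ‖z - 1‖) ^ 2) :=
          mul_le_mul_of_nonneg_left h2 (by positivity)
      _ = 6 * (((k : ℝ)⁻¹ * ‖resolvent a z‖) * (k * ‖z - 1‖)) ^ 2 := by ring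
      _ ≤ 6 * C ^ 2 := by linarith
  rw [cauchyIntegrand, norm_smul]
  calc _ ≤ Real.exp 3 * (6 * C ^ 2 * (1 + y ^ 2)⁻¹) :=
        mul_le_mul h4 h5 (norm_nonneg _) (Real.exp_pos _).le
    _ = _ := by ring

/-- If contractions `a i` satisfy a common resolvent bound of Ritt type and their resolvents,
rescaled by `k i → ∞`, converge pointwise, then the powers `a i ^ k i` converge, and the limit is
given by the limits of the resolvents. -/
theorem tendsto_pow_of_tendsto_resolvent {ι : Type*} {l : Filter ι} [l.IsCountablyGenerated]
    (h1 : ‖(1 : A)‖ ≤ 1) {a : ι → A} {k : ι → ℕ} (hk : Tendsto k l atTop) {C : ℝ}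
    (ha : ∀ᶠ i in l, ‖a i‖ ≤ 1)
    (hC : ∀ᶠ i in l, ∀ z : ℂ, 1 < ‖z‖ → ‖z‖ ≤ 3 → ‖z - 1‖ * ‖resolvent (a i) z‖ ≤ C)
    {F : ℝ → A} (hF : ∀ y : ℝ, Tendsto (fun i => (k i : ℂ)⁻¹ •
      resolvent (a i) (Complex.exp ((1 + y * Complex.I) / k i))) l (𝓝 (F y))) :
    Tendsto (fun i => a i ^ k i) l
      (𝓝 (((2 * Real.pi)⁻¹ : ℝ) • ∫ y : ℝ, Complex.exp (1 + y * Complex.I) • F y ^ 2)) := by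
  have hkpos : ∀ᶠ i in l, 0 < k i := hk.eventually_gt_atTop 0
  have hkR : Tendsto (fun i => (k i : ℝ)) l atTop := tendsto_natCast_atTop_atTop.comp hk
  have hlim : Tendsto (fun i => ∫ y, Set.indicator (Set.Ioc (-(Real.pi * k i)) (Real.pi * k i))
      (cauchyIntegrand (a i) (k i)) y) l
      (𝓝 (∫ y : ℝ, Complex.exp (1 + y * Complex.I) • F y ^ 2)) := by
    refine tendsto_integral_filter_of_dominated_convergence
      (fun y => 6 * Real.exp 3 * C ^ 2 * (1 + y ^ 2)⁻¹) ?_ ?_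
      (integrable_inv_one_add_sq.const_mul _) ?_
    · filter_upwards [ha, hkpos] with i hai hki
      exact (continuous_cauchyIntegrand h1 hai hki).aestronglyMeasurable.indicator
        measurableSet_Ioc
    · filter_upwards [hC, hkpos] with i hCi hki
      refine Eventually.of_forall fun y => ?_
      by_cases hy : y ∈ Set.Ioc (-(Real.pi * k i)) (Real.pi * k i)
      · rw [Set.indicator_of_mem hy]
        exact norm_cauchyIntegrand_le hki hCi (abs_le.2 ⟨hy.1.le, hy.2⟩)
      · rw [Set.indicator_of_notMem hy, norm_zero]
        positivity
    · refine Eventually.of_forall fun y => ?_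
      have hinv : Tendsto (fun i => ((k i : ℝ)⁻¹ : ℝ)) l (𝓝 0) := tendsto_inv_atTop_zero.comp hkR
      have hinvc : Tendsto (fun i => ((k i : ℂ)⁻¹)) l (𝓝 0) := by
        have := (Complex.continuous_ofReal.tendsto 0).comp hinv
        simpa [Function.comp_def] using this
      have e1 : Tendsto (fun i => (k i / (k i + 1) : ℂ)) l (𝓝 1) := by
        have h2 : Tendsto (fun i => (1 + (k i : ℂ)⁻¹)⁻¹) l (𝓝 (1 + 0)⁻¹) :=
          (tendsto_const_nhds.add hinvc).inv₀ (by simp)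
        rw [add_zero, inv_one] at h2
        refine h2.congr' ?_
        filter_upwards [hkpos] with i hki
        have hki' : (k i : ℂ) ≠ 0 := by exact_mod_cast hki.ne'
        have hk1 : (k i : ℂ) + 1 ≠ 0 := by exact_mod_cast (k i).succ_ne_zero
        field_simp
      have e2 : Tendsto (fun i => Complex.exp ((1 + y * Complex.I) / k i) ^ (k i + 2)) l
          (𝓝 (Complex.exp (1 + y * Complex.I))) := by
        have h2 : Tendsto (fun i => Complex.exp ((1 + y * Complex.I) * (1 + 2 * (k i : ℂ)⁻¹))) l
            (𝓝 (Complex.exp ((1 + y * Complex.I) * (1 + 2 * 0)))) :=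
          (Complex.continuous_exp.tendsto _).comp
            (tendsto_const_nhds.mul (tendsto_const_nhds.add (tendsto_const_nhds.mul hinvc)))
        rw [mul_zero, add_zero, mul_one] at h2
        refine h2.congr' ?_
        filter_upwards [hkpos] with i hki
        have hki' : (k i : ℂ) ≠ 0 := by exact_mod_cast hki.ne'
        rw [← Complex.exp_nat_mul]
        congr 1
        push_cast
        field_simp
      have e3 := (e1.mul e2).smul ((hF y).pow 2)
      rw [one_mul] at e3
      refine e3.congr' ?_
      have hy : ∀ᶠ i in l, |y| / Real.pi < k i := hkR.eventually_gt_atTop _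
      filter_upwards [hy] with i hi
      rw [div_lt_iff₀ Real.pi_pos, mul_comm] at hi
      have hmem : y ∈ Set.Ioc (-(Real.pi * k i)) (Real.pi * k i) :=
        ⟨(abs_lt.1 hi).1, (abs_lt.1 hi).2.le⟩
      rw [Set.indicator_of_mem hmem, cauchyIntegrand]
  refine (hlim.const_smul ((2 * Real.pi)⁻¹ : ℝ)).congr' ?_
  filter_upwards [ha, hkpos] with i hai hki
  exact (pow_eq_integral_cauchyIntegrand h1 hai hki).symm

end CauchyIntegral

/-! ### Continuous semigroups -/

/-- A continuous one-parameter semigroup in a Banach algebra is an exponential. Averaging over a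
short interval, whose average is invertible, shows that the semigroup is differentiable. -/
theorem exists_eq_exp_of_semigroup {A : Type*} [NormedRing A] [NormedAlgebra ℝ A] [CompleteSpace A]
    {F : ℝ → A} (hc : ContinuousOn F (Set.Ici 0)) (h0 : F 0 = 1)
    (hadd : ∀ s t : ℝ, 0 ≤ s → 0 ≤ t → F (s + t) = F s * F t) :
    ∃ a : A, ∀ t : ℝ, 0 ≤ t → F t = NormedSpace.exp (t • a) := by
  set G : ℝ → A := fun t => F (max t 0) with hG
  have hGc : Continuous G := hc.comp_continuous (by fun_prop) fun t => le_max_right t 0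
  have hGF : ∀ t : ℝ, 0 ≤ t → G t = F t := fun t ht => by simp only [hG, max_eq_left ht]
  set J : ℝ → A := fun t => ∫ s in (0 : ℝ)..t, G s with hJ
  have hJd : ∀ t, HasDerivAt J (G t) t := fun t => intervalIntegral.integral_hasDerivAt_right
    (hGc.intervalIntegrable _ _) (hGc.stronglyMeasurableAtFilter _ _) hGc.continuousAt
  obtain ⟨h, hh, hunit⟩ : ∃ h : ℝ, 0 < h ∧ IsUnit (J h) := by
    have h1 := (hasDerivAt_iff_tendsto_slope_zero.1 (hJd 0)).mono_left
      (nhdsWithin_mono (0 : ℝ) (s := Set.Ioi 0) fun t (ht : 0 < t) => ht.ne')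
    rw [hGF 0 le_rfl, h0] at h1
    obtain ⟨t, h2, ht⟩ := ((h1.eventually (Units.isOpen.mem_nhds isUnit_one)).and
      self_mem_nhdsWithin).exists
    refine ⟨t, ht, ?_⟩
    have hJ0 : J 0 = 0 := by simp [hJ]
    have h3 : IsUnit (t⁻¹ • J t) := by simpa [hJ0] using h2
    have h4 := h3.smul (Units.mk0 t ht.ne')
    rwa [Units.smul_def, Units.val_mk0, smul_smul, mul_inv_cancel₀ ht.ne', one_smul] at h4
  obtain ⟨u, hu⟩ := hunit
  set b : A := (↑u⁻¹ : A) with hb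
  have hub : J h * b = 1 := by rw [← hu, hb, Units.mul_inv]
  set H : ℝ → A := fun t => (J (t + h) - J t) * b with hH
  have hFH : ∀ t : ℝ, 0 ≤ t → F t = H t := by
    intro t ht
    have h1 : F t * J h = J (t + h) - J t := by
      have h2 : F t * J h = ∫ s in (0 : ℝ)..h, F t * G s := by
        have := ((ContinuousLinearMap.mul ℝ A) (F t)).intervalIntegral_comp_comm
          (hGc.intervalIntegrable (μ := MeasureTheory.volume) 0 h)
        simpa using this.symm
      have h3 : ∫ s in (0 : ℝ)..h, F t * G s = ∫ s in (0 : ℝ)..h, G (t + s) := by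
        refine intervalIntegral.integral_congr fun s hs => ?_
        rw [Set.uIcc_of_le hh.le] at hs
        rw [hGF s hs.1, hGF (t + s) (add_nonneg ht hs.1), hadd t s ht hs.1]
      rw [h2, h3, intervalIntegral.integral_comp_add_left, add_zero]
      exact (intervalIntegral.integral_interval_sub_left (hGc.intervalIntegrable _ _)
        (hGc.intervalIntegrable _ _)).symm
    simp only [hH]
    rw [← h1, mul_assoc, hub, mul_one]
  set a : A := (F h - 1) * b with ha
  have hHd : ∀ t : ℝ, 0 ≤ t → HasDerivAt H (H t * a) t := by
    intro t ht
    have h1 : HasDerivAt (fun t => J (t + h)) (G (t + h)) t := (hJd (t + h)).comp_add_const t h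
    refine ((h1.sub (hJd t)).mul_const b).congr_deriv ?_
    rw [hGF t ht, hGF (t + h) (by linarith), hadd t h ht hh.le, ← hFH t ht, ha]
    noncomm_ring
  refine ⟨a, fun T hT => ?_⟩
  -- `H t * exp ((T - t) a)` interpolates between the two sides
  have hder : ∀ t : ℝ, 0 ≤ t →
      HasDerivAt (fun t => H t * NormedSpace.exp ((T - t) • a)) 0 t := by
    intro t ht
    have h1 : HasDerivAt (fun t => NormedSpace.exp ((T - t) • a))
        ((-1 : ℝ) • (a * NormedSpace.exp ((T - t) • a))) t :=
      (hasDerivAt_exp_smul_const' a (T - t)).scomp t ((hasDerivAt_id t).const_sub T)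
    refine ((hHd t ht).mul h1).congr_deriv ?_
    rw [neg_one_smul]
    noncomm_ring
  have h1 := constant_of_has_deriv_right_zero (a := 0) (b := T)
    (fun t ht => (hder t ht.1).continuousAt.continuousWithinAt)
    (fun t ht => (hder t ht.1).hasDerivWithinAt) T ⟨hT, le_rfl⟩
  simp only [sub_self, zero_smul, NormedSpace.exp_zero, mul_one, sub_zero] at h1
  rw [hFH T hT, h1, ← hFH 0 le_rfl, h0, one_mul]

/-! ### Stochastic projections and semigroups of stochastic matrices -/

section Stochastic

variable {Ω : Type*} [Fintype Ω] [DecidableEq Ω]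

theorem isCompact_rowStochastic :
    IsCompact (Matrix.rowStochastic ℝ Ω : Set (Matrix Ω Ω ℝ)) := by
  have hK : IsCompact (Set.univ.pi fun _ : Ω => Set.univ.pi fun _ : Ω => Set.Icc (0 : ℝ) 1) :=
    isCompact_univ_pi fun _ => isCompact_univ_pi fun _ => isCompact_Icc
  have hcl : IsClosed (Matrix.rowStochastic ℝ Ω : Set (Matrix Ω Ω ℝ)) := by
    have : (Matrix.rowStochastic ℝ Ω : Set (Matrix Ω Ω ℝ))
        = (⋂ x, ⋂ y, {T : Matrix Ω Ω ℝ | 0 ≤ T x y}) ∩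
          ⋂ x, {T : Matrix Ω Ω ℝ | ∑ y, T x y = 1} := by
      ext T
      simp [Matrix.mem_rowStochastic_iff_sum]
    rw [this]
    refine (isClosed_iInter fun x => isClosed_iInter fun y =>
      isClosed_le continuous_const (continuous_id.matrix_elem x y)).inter (isClosed_iInter fun x =>
        isClosed_eq (continuous_finsetSum _ fun y _ => continuous_id.matrix_elem x y)
          continuous_const)
  exact hK.of_isClosed_subset hcl fun T hT x _ y _ =>
    ⟨Matrix.nonneg_of_mem_rowStochastic hT, Matrix.le_one_of_mem_rowStochastic hT⟩

/-- A semigroup of stochastic matrices that is continuous on `(0, ∞)` has a limit at `0+`, and this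
limit acts on it as an identity. By compactness there are limit points, and each of them is
an identity for the semigroup, hence also for the other limit points. -/
theorem exists_tendsto_zero_of_semigroup {P : ℝ → Matrix Ω Ω ℝ}
    (hP : ∀ t, 0 < t → P t ∈ Matrix.rowStochastic ℝ Ω)
    (hadd : ∀ s t, 0 < s → 0 < t → P (s + t) = P s * P t)
    (hcont : ∀ t, 0 < t → ContinuousAt P t) :
    ∃ E₀ ∈ Matrix.rowStochastic ℝ Ω, Tendsto P (𝓝[>] 0) (𝓝 E₀) ∧ E₀ * E₀ = E₀ ∧
      ∀ t, 0 < t → E₀ * P t = P t ∧ P t * E₀ = P t := by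
  have hmem : ∀ᶠ t in 𝓝[>] (0 : ℝ), P t ∈ (Matrix.rowStochastic ℝ Ω : Set (Matrix Ω Ω ℝ)) := by
    filter_upwards [self_mem_nhdsWithin] with t ht using hP t ht
  have hshift : ∀ t, 0 < t → Tendsto (fun s => P (t + s)) (𝓝[>] 0) (𝓝 (P t)) := by
    intro t ht
    have h1 : Tendsto (fun s : ℝ => t + s) (𝓝[>] 0) (𝓝 t) := by
      have : Tendsto (fun s : ℝ => t + s) (𝓝 0) (𝓝 (t + 0)) := (continuous_const_add t).tendsto 0
      rw [add_zero] at this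
      exact this.mono_left nhdsWithin_le_nhds
    exact (hcont t ht).tendsto.comp h1
  have hid : ∀ B, MapClusterPt B (𝓝[>] 0) P → ∀ t, 0 < t → B * P t = P t ∧ P t * B = P t := by
    intro B hB t ht
    obtain ⟨U, hU, hUB⟩ := mapClusterPt_iff_ultrafilter.1 hB
    constructor
    · refine tendsto_nhds_unique (hUB.mul_const (P t)) (((hshift t ht).mono_left hU).congr' ?_)
      filter_upwards [hU self_mem_nhdsWithin] with s hs
      rw [add_comm, hadd s t hs ht]
    · refine tendsto_nhds_unique (hUB.const_mul (P t)) (((hshift t ht).mono_left hU).congr' ?_)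
      filter_upwards [hU self_mem_nhdsWithin] with s hs
      exact hadd t s ht hs
  have hmul : ∀ B B', MapClusterPt B (𝓝[>] 0) P → MapClusterPt B' (𝓝[>] 0) P →
      B * B' = B' ∧ B' * B = B' := by
    intro B B' hB hB'
    obtain ⟨U, hU, hUB⟩ := mapClusterPt_iff_ultrafilter.1 hB'
    constructor
    · refine tendsto_nhds_unique (hUB.const_mul B) (hUB.congr' ?_)
      filter_upwards [hU self_mem_nhdsWithin] with s hs using (hid B hB s hs).1.symm
    · refine tendsto_nhds_unique (hUB.mul_const B) (hUB.congr' ?_)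
      filter_upwards [hU self_mem_nhdsWithin] with s hs using (hid B hB s hs).2.symm
  obtain ⟨B, hBmem, hB⟩ := isCompact_rowStochastic.exists_mapClusterPt
    (f := 𝓝[>] (0 : ℝ)) (u := P) (le_principal_iff.2 hmem)
  exact ⟨B, hBmem, isCompact_rowStochastic.tendsto_nhds_of_unique_mapClusterPt hmem
    fun B' _ hB' => (hmul B B' hB hB').1.symm.trans (hmul B' B hB' hB).2, (hmul B B hB hB).1,
    hid B hB⟩

/-- Rows of a stochastic projection are equal when one of the states is charged by some row and
leads to the other. With `m` the row charging `y` and `f` a column, `m` is invariant and `f` is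
harmonic, so that `∑ m(y) Π(y, w) (f(w) - f(y))² = 0`. -/
theorem row_eq_of_stochastic_idempotent {S : Matrix Ω Ω ℝ} (hS : S ∈ Matrix.rowStochastic ℝ Ω)
    (hidem : S * S = S) {x y w : Ω} (hxy : 0 < S x y) (hyw : 0 < S y w) : S w = S y := by
  funext z
  have hnn : ∀ x y, 0 ≤ S x y := fun x y => Matrix.nonneg_of_mem_rowStochastic hS
  have hmul : ∀ x z, ∑ y, S x y * S y z = S x z := fun x z => by
    conv_rhs => rw [← hidem]
    rfl
  have hsum : ∑ y, ∑ w, S x y * S y w * (S w z - S y z) ^ 2 = 0 := by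
    have h1 : ∀ y, ∑ w, S x y * S y w * (S w z - S y z) ^ 2
        = S x y * ∑ w, S y w * S w z ^ 2 - S x y * S y z ^ 2 := by
      intro y
      have h2 : ∀ w, S x y * S y w * (S w z - S y z) ^ 2 = S x y * (S y w * S w z ^ 2)
          - 2 * S x y * S y z * (S y w * S w z) + S x y * S y z ^ 2 * S y w := fun w => by ring
      simp only [h2, Finset.sum_add_distrib, Finset.sum_sub_distrib, ← Finset.mul_sum, hmul,
        Matrix.sum_row_of_mem_rowStochastic hS]
      ring
    simp only [h1, Finset.sum_sub_distrib]
    have h3 : ∑ y, S x y * ∑ w, S y w * S w z ^ 2 = ∑ w, S x w * S w z ^ 2 := by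
      simp only [Finset.mul_sum, ← mul_assoc]
      rw [Finset.sum_comm]
      simp only [← Finset.sum_mul, hmul]
    rw [h3, sub_self]
  have h1 := (Finset.sum_eq_zero_iff_of_nonneg fun y _ => Finset.sum_nonneg fun w _ =>
    mul_nonneg (mul_nonneg (hnn x y) (hnn y w)) (sq_nonneg _)).1 hsum y (Finset.mem_univ y)
  have h2 := (Finset.sum_eq_zero_iff_of_nonneg fun w _ =>
    mul_nonneg (mul_nonneg (hnn x y) (hnn y w)) (sq_nonneg _)).1 h1 w (Finset.mem_univ w)
  have h3 : (S w z - S y z) ^ 2 = 0 := (mul_eq_zero.1 h2).resolve_left (mul_pos hxy hyw).ne'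
  linarith [pow_eq_zero_iff (two_ne_zero) |>.1 h3]

/-- A stochastic projection factors through its classes: `S = μ * M`, where the rows of `M` are the
distinct rows of `S` at recurrent states and `μ` gives the probabilities of entering the classes. -/
theorem exists_factorization_of_stochastic_idempotent {S : Matrix Ω Ω ℝ}
    (hS : S ∈ Matrix.rowStochastic ℝ Ω) (hidem : S * S = S) :
    ∃ (L : ℕ) (R : Fin L → Finset Ω) (μ : Matrix Ω (Fin L) ℝ) (M : Matrix (Fin L) Ω ℝ),
      L ≤ Fintype.card Ω ∧ (∀ i, (R i).Nonempty) ∧ (Pairwise fun i j => Disjoint (R i) (R j)) ∧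
      (∀ x, μ x ∈ stdSimplex ℝ (Fin L)) ∧ (∀ i, ∀ x ∈ R i, μ x i = 1) ∧
      (∀ i, M i ∈ stdSimplex ℝ Ω) ∧ (∀ i, ∀ x, x ∉ R i → M i x = 0) ∧ μ * M = S ∧ M * μ = 1 := by
  classical
  have hnn : ∀ x y, 0 ≤ S x y := fun x y => Matrix.nonneg_of_mem_rowStochastic hS
  have hmul : ∀ x z, ∑ y, S x y * S y z = S x z := fun x z => by
    conv_rhs => rw [← hidem]
    rfl
  set rec : Finset Ω := Finset.univ.filter fun y => ∃ x, 0 < S x y with hrec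
  have mem_rec : ∀ {y}, y ∈ rec ↔ ∃ x, 0 < S x y := fun {y} => by simp [hrec]
  have hzero : ∀ {x y}, y ∉ rec → S x y = 0 := fun {x y} hy =>
    le_antisymm (not_lt.1 fun h => hy (mem_rec.2 ⟨x, h⟩)) (hnn x y)
  have hrow : ∀ {y w}, y ∈ rec → 0 < S y w → S w = S y := fun {y w} hy hw => by
    obtain ⟨x, hx⟩ := mem_rec.1 hy
    exact row_eq_of_stochastic_idempotent hS hidem hx hw
  set rows : Finset (Ω → ℝ) := rec.image fun y => S y with hrows
  set r : Fin rows.card → Ω → ℝ := fun i => (rows.equivFin.symm i).1 with hr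
  have hrinj : Function.Injective r := fun i j hij =>
    rows.equivFin.symm.injective (Subtype.ext hij)
  have hrmem : ∀ i, ∃ y ∈ rec, S y = r i := fun i =>
    Finset.mem_image.1 (rows.equivFin.symm i).2
  have hrsurj : ∀ y ∈ rec, ∃ i, r i = S y := fun y hy =>
    ⟨rows.equivFin ⟨S y, Finset.mem_image_of_mem _ hy⟩, by simp [hr]⟩
  set R : Fin rows.card → Finset Ω := fun i => rec.filter fun y => S y = r i with hR
  have mem_R : ∀ {i y}, y ∈ R i ↔ y ∈ rec ∧ S y = r i := fun {i y} => by simp [hR]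
  have hsupp : ∀ i x, x ∉ R i → r i x = 0 := by
    intro i x hx
    obtain ⟨y, hy, hyi⟩ := hrmem i
    by_contra hne
    have hpos : 0 < S y x := lt_of_le_of_ne (hnn y x) (by rw [hyi]; exact Ne.symm hne)
    exact hx (mem_R.2 ⟨mem_rec.2 ⟨y, hpos⟩, (hrow hy hpos).trans hyi⟩)
  have hRdisj : Pairwise fun i j => Disjoint (R i) (R j) := by
    intro i j hij
    refine Finset.disjoint_left.2 fun x hxi hxj => hij (hrinj ?_)
    rw [← (mem_R.1 hxi).2, (mem_R.1 hxj).2]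
  have hrsum : ∀ i, ∑ x, r i x = 1 := fun i => by
    obtain ⟨y, _, hyi⟩ := hrmem i
    rw [← hyi]
    exact Matrix.sum_row_of_mem_rowStochastic hS y
  have hrnn : ∀ i x, 0 ≤ r i x := fun i x => by
    obtain ⟨y, _, hyi⟩ := hrmem i
    rw [← hyi]
    exact hnn y x
  have hRsum : ∀ i, ∑ x ∈ R i, r i x = 1 := fun i => by
    rw [← hrsum i]
    exact Finset.sum_subset (Finset.subset_univ _) fun x _ hx => hsupp i x hx
  -- sums over the recurrent states split into sums over the classes
  have hsplit : ∀ f : Ω → ℝ, ∑ i, ∑ w ∈ R i, f w = ∑ w ∈ rec, f w := by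
    intro f
    rw [← Finset.sum_biUnion fun i _ j _ hij => hRdisj hij]
    refine Finset.sum_congr (Finset.ext fun w => ?_) fun _ _ => rfl
    simp only [Finset.mem_biUnion, Finset.mem_univ, true_and, mem_R]
    constructor
    · rintro ⟨i, hw, -⟩; exact hw
    · intro hw
      obtain ⟨i, hi⟩ := hrsurj w hw
      exact ⟨i, hw, hi.symm⟩
  have hμ1 : ∀ i, ∀ x ∈ R i, ∑ w ∈ R i, S x w = 1 := fun i x hx => by
    rw [(mem_R.1 hx).2]
    exact hRsum i
  have hμ0 : ∀ i j, i ≠ j → ∀ x ∈ R i, ∑ w ∈ R j, S x w = 0 := fun i j hij x hx => by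
    refine Finset.sum_eq_zero fun w hw => ?_
    rw [(mem_R.1 hx).2]
    exact hsupp i w fun h => Finset.disjoint_left.1 (hRdisj hij) h hw
  refine ⟨rows.card, R, Matrix.of fun x i => ∑ w ∈ R i, S x w, Matrix.of r,
    Finset.card_image_le.trans (Finset.card_le_univ _), fun i => ?_, hRdisj,
    fun x => ⟨fun i => Finset.sum_nonneg fun w _ => hnn x w, ?_⟩, hμ1,
    fun i => ⟨hrnn i, hrsum i⟩, hsupp, ?_, ?_⟩
  · rw [Finset.nonempty_iff_ne_empty]
    intro h
    have := hRsum i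
    rw [h, Finset.sum_empty] at this
    exact zero_ne_one this
  · simp only [Matrix.of_apply]
    rw [hsplit, ← Matrix.sum_row_of_mem_rowStochastic hS x]
    exact Finset.sum_subset (Finset.subset_univ _) fun w _ hw => hzero hw
  · ext x z
    simp only [Matrix.mul_apply, Matrix.of_apply, Finset.sum_mul]
    have h1 : ∀ i, ∑ w ∈ R i, S x w * r i z = ∑ w ∈ R i, S x w * S w z := fun i =>
      Finset.sum_congr rfl fun w hw => by rw [← (mem_R.1 hw).2]
    simp only [h1]
    rw [hsplit, ← hmul x z]
    exact Finset.sum_subset (Finset.subset_univ _) fun w _ hw => by rw [hzero hw, zero_mul]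
  · ext i j
    simp only [Matrix.mul_apply, Matrix.of_apply]
    have h1 : ∑ x, r i x * ∑ w ∈ R j, S x w = ∑ x ∈ R i, r i x * ∑ w ∈ R j, S x w :=
      (Finset.sum_subset (Finset.subset_univ _) fun x _ hx => by
        rw [hsupp i x hx, zero_mul]).symm
    rw [h1]
    by_cases hij : i = j
    · subst hij
      rw [Matrix.one_apply_eq, ← hRsum i]
      exact Finset.sum_congr rfl fun x hx => by rw [hμ1 i x hx, mul_one]
    · rw [Matrix.one_apply_ne hij]
      exact Finset.sum_eq_zero fun x hx => by rw [hμ0 i j hij x hx, mul_zero]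

end Stochastic

/-! ### The representation of the position as a Markov process on classes -/

section Representation

attribute [local instance] Matrix.linftyOpNormedRing Matrix.linftyOpNormedAlgebra

variable {Ω : Type*} [Fintype Ω] [DecidableEq Ω]

/-- If `exp (t A)` is a stochastic matrix for all `t ≥ 0`, then `A` is a generator. -/
theorem isGenerator_of_exp_mem_rowStochastic {L : ℕ} {A : Matrix (Fin L) (Fin L) ℝ}
    (h : ∀ t : ℝ, 0 ≤ t → NormedSpace.exp (t • A) ∈ Matrix.rowStochastic ℝ (Fin L)) :
    IsGenerator A := by
  have hslope : Tendsto (fun t : ℝ => t⁻¹ • (NormedSpace.exp (t • A) - 1)) (𝓝[>] 0) (𝓝 A) := by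
    have h1 := hasDerivAt_exp_smul_const A (0 : ℝ)
    rw [zero_smul, NormedSpace.exp_zero, one_mul, hasDerivAt_iff_tendsto_slope_zero] at h1
    have h2 := h1.mono_left
      (nhdsWithin_mono (0 : ℝ) (s := Set.Ioi 0) fun t (ht : 0 < t) => ht.ne')
    simp only [zero_add, zero_smul, NormedSpace.exp_zero] at h2
    exact h2
  have hentry : ∀ i j, Tendsto (fun t : ℝ => t⁻¹ * ((NormedSpace.exp (t • A) :
      Matrix (Fin L) (Fin L) ℝ) i j - (1 : Matrix (Fin L) (Fin L) ℝ) i j)) (𝓝[>] 0) (𝓝 (A i j)) :=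
    fun i j => ((continuous_id.matrix_elem i j).tendsto A).comp hslope
  constructor
  · intro i j hij
    refine ge_of_tendsto (hentry i j) ?_
    filter_upwards [self_mem_nhdsWithin] with t (ht : 0 < t)
    rw [Matrix.one_apply_ne hij, sub_zero]
    exact mul_nonneg (inv_nonneg.2 ht.le) (Matrix.nonneg_of_mem_rowStochastic (h t ht.le))
  · intro i
    refine tendsto_nhds_unique (tendsto_finsetSum _ fun j _ => hentry i j)
      (tendsto_const_nhds.congr' ?_)
    filter_upwards [self_mem_nhdsWithin] with t (ht : 0 < t)
    rw [← Finset.mul_sum, Finset.sum_sub_distrib, Matrix.sum_row_of_mem_rowStochastic (h t ht.le),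
      Matrix.sum_row_of_mem_rowStochastic (one_mem (Matrix.rowStochastic ℝ (Fin L))), sub_self,
      mul_zero]

/-- A semigroup of stochastic matrices that is continuous on `[0, ∞)` is the exponential of a
generator, placed between the two factors of the projection `P 0`. -/
theorem exists_isRepresentation {P : ℝ → Matrix Ω Ω ℝ}
    (hP : ∀ t, 0 ≤ t → P t ∈ Matrix.rowStochastic ℝ Ω)
    (hadd : ∀ s t, 0 ≤ s → 0 ≤ t → P (s + t) = P s * P t)
    (hcont : ContinuousOn P (Set.Ici 0)) :
    ∃ (L : ℕ) (R : Fin L → Finset Ω) (μ : Matrix Ω (Fin L) ℝ)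
      (A : Matrix (Fin L) (Fin L) ℝ) (M : Matrix (Fin L) Ω ℝ),
      L ≤ Fintype.card Ω ∧ IsRepresentation P R μ A M := by
  have hidem : P 0 * P 0 = P 0 := by rw [← hadd 0 0 le_rfl le_rfl, add_zero]
  obtain ⟨L, R, μ, M, hL, hne, hdisj, hμ, hμ1, hM, hMsupp, hμM, hMμ⟩ :=
    exists_factorization_of_stochastic_idempotent (hP 0 le_rfl) hidem
  set E : ℝ → Matrix (Fin L) (Fin L) ℝ := fun t => M * P t * μ with hE
  have hE0 : E 0 = 1 := by
    simp only [hE]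
    rw [← hμM, ← Matrix.mul_assoc, hMμ, Matrix.one_mul, hMμ]
  have hEadd : ∀ s t : ℝ, 0 ≤ s → 0 ≤ t → E (s + t) = E s * E t := by
    intro s t hs ht
    have h1 : P s * P t = P s * (μ * M) * P t := by
      rw [hμM, ← hadd s 0 hs le_rfl, add_zero]
    simp only [hE]
    rw [hadd s t hs ht, h1]
    simp only [Matrix.mul_assoc]
  have hEc : ContinuousOn E (Set.Ici 0) := by
    have hlin : Continuous fun X : Matrix Ω Ω ℝ => M * X * μ :=
      (continuous_const.matrix_mul continuous_id).matrix_mul continuous_const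
    exact hlin.comp_continuousOn hcont
  obtain ⟨A, hA⟩ := exists_eq_exp_of_semigroup hEc hE0 hEadd
  have hEst : ∀ t : ℝ, 0 ≤ t → E t ∈ Matrix.rowStochastic ℝ (Fin L) := by
    intro t ht
    rw [Matrix.mem_rowStochastic_iff_sum]
    constructor
    · intro i j
      simp only [hE, Matrix.mul_apply]
      exact Finset.sum_nonneg fun x _ => mul_nonneg (Finset.sum_nonneg fun y _ =>
        mul_nonneg ((hM i).1 y) (Matrix.nonneg_of_mem_rowStochastic (hP t ht))) ((hμ x).1 j)
    · intro i
      simp only [hE, Matrix.mul_apply]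
      rw [Finset.sum_comm]
      simp only [← Finset.mul_sum, (hμ _).2, mul_one]
      rw [Finset.sum_comm]
      simp only [← Finset.mul_sum, Matrix.sum_row_of_mem_rowStochastic (hP t ht), mul_one]
      exact (hM i).2
  refine ⟨L, R, μ, A, M, hL, hne, hdisj, hμ, hμ1,
    isGenerator_of_exp_mem_rowStochastic fun t ht => hA t ht ▸ hEst t ht, hM, hMsupp,
    fun t ht => ?_⟩
  have h1 : P t = P 0 * P t * P 0 := by
    rw [← hadd 0 t le_rfl ht, zero_add, ← hadd t 0 ht le_rfl, add_zero]
  have h2 : μ * E t * M = P t := by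
    conv_rhs => rw [h1, ← hμM]
    simp only [hE, Matrix.mul_assoc]
  rw [← h2, hA t ht]
  rfl

/-! ### The exponential of a matrix in Jordan form -/

theorem jordanBlock_eq (v : ℂ) (m : ℕ) : jordanBlock v m = v • 1 + jordanBlock 0 m := by
  ext i j
  by_cases h : i = j
  · subst h; simp [jordanBlock]
  · simp [jordanBlock, h, Matrix.one_apply_ne h]

theorem jordanBlock_zero_pow_apply {m : ℕ} (k : ℕ) (i j : Fin m) (h : (j : ℕ) ≠ i + k) :
    (jordanBlock 0 m ^ k) i j = 0 := by
  induction k generalizing j with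
  | zero => exact Matrix.one_apply_ne fun e => h (by simp [e])
  | succ k ih =>
    rw [pow_succ, Matrix.mul_apply]
    refine Finset.sum_eq_zero fun l _ => ?_
    by_cases hl : (l : ℕ) = i + k
    · have : jordanBlock 0 m l j = 0 := by
        simp only [jordanBlock, Matrix.of_apply]
        rw [if_neg (show ¬ (j : ℕ) = l + 1 by omega), ite_self]
      rw [this, mul_zero]
    · rw [ih l hl, zero_mul]

theorem jordanBlock_zero_pow_eq_zero {m k : ℕ} (h : m ≤ k) : jordanBlock 0 m ^ k = 0 := by
  ext i j
  exact jordanBlock_zero_pow_apply k i j (by omega)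

theorem exp_smul_jordanBlock (v : ℂ) (m : ℕ) (t : ℂ) :
    NormedSpace.exp (t • jordanBlock v m) = ∑ k ∈ Finset.range m,
      (Complex.exp (t * v) * t ^ k) • ((k.factorial : ℂ)⁻¹ • jordanBlock 0 m ^ k) := by
  have h1 : NormedSpace.exp (t • jordanBlock 0 m) = ∑ k ∈ Finset.range m,
      t ^ k • ((k.factorial : ℂ)⁻¹ • jordanBlock 0 m ^ k) := by
    rw [NormedSpace.exp_eq_tsum ℂ]
    beta_reduce
    rw [tsum_eq_sum (s := Finset.range m)]
    · exact Finset.sum_congr rfl fun k _ => by rw [smul_pow, smul_comm]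
    · intro k hk
      rw [smul_pow, jordanBlock_zero_pow_eq_zero (by simpa using hk), smul_zero, smul_zero]
  have h2 : NormedSpace.exp ((t * v) • (1 : Matrix (Fin m) (Fin m) ℂ))
      = Complex.exp (t * v) • 1 := by
    rw [Matrix.smul_one_eq_diagonal, Matrix.exp_diagonal, Matrix.smul_one_eq_diagonal]
    congr 1
    funext i
    rw [Pi.coe_exp, Complex.exp_eq_exp_ℂ]
  rw [jordanBlock_eq, smul_add, smul_smul, Matrix.exp_add_of_commute _ _
    (((Commute.one_left _).smul_left _).smul_right _), h1, h2, smul_mul_assoc, one_mul,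
    Finset.smul_sum]
  exact Finset.sum_congr rfl fun k _ => by rw [smul_smul]

/-- The exponential commutes with the conjugation of matrices by an invertible rectangular matrix,
whose rows and columns may have different index types. -/
theorem exp_conj_of_mul_eq_one {m n : Type*} [Fintype m] [DecidableEq m] [Fintype n] [DecidableEq n]
    (S : Matrix m n ℂ) (T : Matrix n m ℂ) (hST : S * T = 1) (hTS : T * S = 1) (D : Matrix n n ℂ) :
    NormedSpace.exp (S * D * T) = S * NormedSpace.exp D * T := by
  let f : Matrix n n ℂ →+* Matrix m m ℂ :=
    { toFun := fun X => S * X * T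
      map_one' := by rw [Matrix.mul_one, hST]
      map_zero' := by rw [Matrix.mul_zero, Matrix.zero_mul]
      map_add' := fun X Y => by rw [Matrix.mul_add, Matrix.add_mul]
      map_mul' := fun X Y => by
        have : X * Y = X * (T * S) * Y := by rw [hTS, Matrix.mul_one]
        rw [this]
        simp only [Matrix.mul_assoc] }
  have hf : Continuous f :=
    (continuous_const.matrix_mul continuous_id).matrix_mul continuous_const
  let _ : NormedAlgebra ℚ (Matrix n n ℂ) := NormedAlgebra.restrictScalars ℚ ℂ _
  exact (NormedSpace.map_exp f hf D).symm

theorem exists_exp_smul_eq_of_hasJordanForm {L r : ℕ} {B : Matrix (Fin L) (Fin L) ℂ}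
    {v : Fin r → ℂ} {m : Fin r → ℕ} (h : HasJordanForm B v m) :
    ∃ b : Fin r → ℕ → Matrix (Fin L) (Fin L) ℂ, ∀ t : ℂ, NormedSpace.exp (t • B) =
      ∑ i, ∑ k ∈ Finset.range (m i), (Complex.exp (t * v i) * t ^ k) • b i k := by
  obtain ⟨-, S, T, hST, hTS, rfl⟩ := h
  refine ⟨fun i k => S * Matrix.blockDiagonal' (Pi.single i ((k.factorial : ℂ)⁻¹ •
    jordanBlock 0 (m i) ^ k) : ∀ i, Matrix (Fin (m i)) (Fin (m i)) ℂ) * T, fun t => ?_⟩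
  have h1 : NormedSpace.exp (t • Matrix.blockDiagonal' fun i => jordanBlock (v i) (m i))
      = ∑ i, ∑ k ∈ Finset.range (m i), (Complex.exp (t * v i) * t ^ k) •
        Matrix.blockDiagonal' (Pi.single i ((k.factorial : ℂ)⁻¹ • jordanBlock 0 (m i) ^ k) :
          ∀ i, Matrix (Fin (m i)) (Fin (m i)) ℂ) := by
    rw [← Matrix.blockDiagonal'_smul, Matrix.exp_blockDiagonal']
    have h2 : NormedSpace.exp (t • fun i => jordanBlock (v i) (m i)) = ∑ i,
        ∑ k ∈ Finset.range (m i), (Complex.exp (t * v i) * t ^ k) •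
        (Pi.single i ((k.factorial : ℂ)⁻¹ • jordanBlock 0 (m i) ^ k) :
          ∀ i, Matrix (Fin (m i)) (Fin (m i)) ℂ) := by
      rw [← Finset.univ_sum_single (NormedSpace.exp (t • fun i => jordanBlock (v i) (m i)))]
      refine Finset.sum_congr rfl fun i _ => ?_
      let _ : ∀ i, NormedAlgebra ℚ (Matrix (Fin (m i)) (Fin (m i)) ℂ) := fun i =>
        NormedAlgebra.restrictScalars ℚ ℂ _
      have h3 : NormedSpace.exp (t • fun i => jordanBlock (v i) (m i)) i
          = NormedSpace.exp (t • jordanBlock (v i) (m i)) := Pi.coe_exp _ i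
      rw [h3, exp_smul_jordanBlock]
      refine (map_sum (AddMonoidHom.single (fun i => Matrix (Fin (m i)) (Fin (m i)) ℂ) i) _
        _).trans ?_
      exact Finset.sum_congr rfl fun k _ => Pi.single_smul _ _ _
    rw [h2]
    have h3 : ∀ {ι : Type} (s : Finset ι) (f : ι → ∀ i, Matrix (Fin (m i)) (Fin (m i)) ℂ),
        Matrix.blockDiagonal' (∑ j ∈ s, f j) = ∑ j ∈ s, Matrix.blockDiagonal' (f j) :=
      fun s f => map_sum (Matrix.blockDiagonal'AddMonoidHom _ _ _) f s
    simp only [h3, Matrix.blockDiagonal'_smul]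
  rw [← Matrix.smul_mul, ← Matrix.mul_smul, exp_conj_of_mul_eq_one S T hST hTS, h1]
  simp only [Matrix.mul_sum, Matrix.sum_mul, Matrix.mul_smul, Matrix.smul_mul]

theorem map_ofReal_mul {l m n : Type*} [Fintype m] (X : Matrix l m ℝ) (Y : Matrix m n ℝ) :
    (X * Y).map Complex.ofReal = X.map Complex.ofReal * Y.map Complex.ofReal :=
  Matrix.map_mul (f := Complex.ofRealHom)

/-- The expansion of the position along the Jordan form of the generator: the block with
eigenvalue `v` contributes `exp (s v) * s ^ k` at time `s = -log (1 - t)`. -/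
theorem exists_jordan_expansion {P : ℝ → Matrix Ω Ω ℝ} {L : ℕ} {R : Fin L → Finset Ω}
    {μ : Matrix Ω (Fin L) ℝ} {A : Matrix (Fin L) (Fin L) ℝ} {M : Matrix (Fin L) Ω ℝ}
    (h : IsRepresentation P R μ A M) {r : ℕ} {v : Fin r → ℂ} {m : Fin r → ℕ}
    (hJ : HasJordanForm (A.map (fun a : ℝ => (a : ℂ))) v m) :
    ∃ a : Fin r → ℕ → Ω → Ω → ℂ, ∀ t ∈ Set.Ico (0 : ℝ) 1, ∀ x y : Ω,
      ((positionAtFraction P t x y : ℝ) : ℂ) =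
        ∑ i, ∑ k ∈ Finset.range (m i),
          a i k x y * (((1 - t : ℝ) : ℂ) ^ (-v i) * ((Real.log (1 - t) : ℝ) : ℂ) ^ k) := by
  obtain ⟨b, hb⟩ := exists_exp_smul_eq_of_hasJordanForm hJ
  refine ⟨fun i k x y => (-1) ^ k *
    (μ.map Complex.ofReal * b i k * M.map Complex.ofReal) x y, fun t ht x y => ?_⟩
  have ht0 : 0 < 1 - t := by linarith [ht.2]
  set s : ℝ := -Real.log (1 - t) with hs
  have hs0 : 0 ≤ s := by
    rw [hs, neg_nonneg]
    exact Real.log_nonpos ht0.le (by linarith [ht.1])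
  have hexp : (NormedSpace.exp (s • A)).map Complex.ofReal
      = NormedSpace.exp ((s : ℂ) • A.map Complex.ofReal) := by
    have hf : Continuous (Complex.ofRealHom.mapMatrix :
        Matrix (Fin L) (Fin L) ℝ →+* Matrix (Fin L) (Fin L) ℂ) :=
      continuous_id.matrix_map Complex.continuous_ofReal
    let _ : NormedAlgebra ℚ (Matrix (Fin L) (Fin L) ℝ) := NormedAlgebra.restrictScalars ℚ ℝ _
    have h1 := NormedSpace.map_exp _ hf (s • A)
    refine h1.trans (congrArg _ ?_)
    ext i j
    simp
  have hmap : (P s).map Complex.ofReal = μ.map Complex.ofReal *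
      NormedSpace.exp ((s : ℂ) • A.map Complex.ofReal) * M.map Complex.ofReal := by
    rw [h.eq_exp s hs0, ← hexp]
    rw [map_ofReal_mul, map_ofReal_mul]
  have hlog : Complex.log ((1 - t : ℝ) : ℂ) = ((Real.log (1 - t) : ℝ) : ℂ) :=
    (Complex.ofReal_log ht0.le).symm
  have hne : ((1 - t : ℝ) : ℂ) ≠ 0 := by exact_mod_cast ht0.ne'
  calc ((positionAtFraction P t x y : ℝ) : ℂ) = (P s).map Complex.ofReal x y := rfl
    _ = _ := by
      rw [hmap, show A.map Complex.ofReal = A.map (fun a : ℝ => (a : ℂ)) from rfl, hb]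
      simp only [Matrix.mul_sum, Matrix.sum_mul, Matrix.mul_smul, Matrix.smul_mul,
        Matrix.sum_apply, Matrix.smul_apply, smul_eq_mul]
      refine Finset.sum_congr rfl fun i _ => Finset.sum_congr rfl fun k _ => ?_
      rw [Complex.cpow_def_of_ne_zero hne, hlog, hs, Complex.ofReal_neg, neg_mul, mul_neg,
        neg_pow (Real.log (1 - t) : ℂ)]
      ring

end Representation

/-! ### Convergence of the powers on the time scale `1 / lam` -/

/-- The filter on pairs `(lam, n)` along which `lam → 0+` and `n * lam → τ`. -/
def scaleFilter (τ : ℝ) : Filter (ℝ × ℕ) :=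
  (𝓝[>] (0 : ℝ) ×ˢ ⊤) ⊓ comap (fun p : ℝ × ℕ => (p.2 : ℝ) * p.1) (𝓝 τ)

instance (τ : ℝ) : (scaleFilter τ).IsCountablyGenerated := by
  unfold scaleFilter
  infer_instance

theorem tendsto_fst_scaleFilter (τ : ℝ) : Tendsto Prod.fst (scaleFilter τ) (𝓝[>] (0 : ℝ)) :=
  tendsto_fst.mono_left inf_le_left

theorem tendsto_mul_scaleFilter (τ : ℝ) :
    Tendsto (fun p : ℝ × ℕ => (p.2 : ℝ) * p.1) (scaleFilter τ) (𝓝 τ) :=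
  tendsto_comap.mono_left inf_le_right

theorem tendsto_scaleFilter {ι : Type*} {l : Filter ι} {f : ι → ℝ} {k : ι → ℕ} {τ : ℝ}
    (hf : Tendsto f l (𝓝[>] 0)) (hk : Tendsto (fun i => (k i : ℝ) * f i) l (𝓝 τ)) :
    Tendsto (fun i => (f i, k i)) l (scaleFilter τ) :=
  tendsto_inf.2 ⟨hf.prodMk tendsto_top, tendsto_comap_iff.2 hk⟩

theorem tendsto_snd_scaleFilter {τ : ℝ} (hτ : 0 < τ) :
    Tendsto Prod.snd (scaleFilter τ) (atTop : Filter ℕ) := by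
  rw [← tendsto_natCast_atTop_iff (R := ℝ)]
  refine ((tendsto_mul_scaleFilter τ).pos_mul_atTop hτ
    (tendsto_inv_nhdsGT_zero.comp (tendsto_fst_scaleFilter τ))).congr' ?_
  filter_upwards [(tendsto_fst_scaleFilter τ).eventually self_mem_nhdsWithin]
    with p (hp : 0 < p.1)
  simp only [Function.comp_apply]
  field_simp

theorem Filter.Eventually.scaleFilter_nhds {q : ℝ × ℕ → Prop} {t : ℝ}
    (h : ∀ᶠ p in scaleFilter t, q p) : ∀ᶠ τ in 𝓝 t, ∀ᶠ p in scaleFilter τ, q p := by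
  obtain ⟨s, hs, w, ⟨W, hW, hWw⟩, hsw⟩ := eventually_inf.1 h
  filter_upwards [eventually_mem_nhds_iff.2 hW] with τ hτ
  exact eventually_inf.2 ⟨s, hs, _, ⟨W, hτ, hWw⟩, hsw⟩

theorem tendsto_floor_scaleFilter {t : ℝ} (ht : 0 ≤ t) :
    Tendsto (fun lam : ℝ => (lam, ⌊t / lam⌋₊)) (𝓝[>] 0) (scaleFilter t) := by
  refine tendsto_scaleFilter tendsto_id ?_
  refine ((tendsto_nat_floor_mul_div_atTop ht).comp tendsto_inv_nhdsGT_zero).congr fun lam => ?_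
  simp only [Function.comp_apply, div_eq_mul_inv, inv_inv]

section Convergence

attribute [local instance] Matrix.linftyOpNormedRing Matrix.linftyOpNormedAlgebra

variable {Ω : Type*} [Fintype Ω] [DecidableEq Ω]

theorem norm_map_ofReal_le_one {T : Matrix Ω Ω ℝ} (hT : T ∈ Matrix.rowStochastic ℝ Ω) :
    ‖T.map Complex.ofReal‖ ≤ 1 := by
  rw [Matrix.linfty_opNorm_def, NNReal.coe_le_one]
  refine Finset.sup_le fun x _ => ?_
  rw [← NNReal.coe_le_coe]
  push_cast
  refine le_of_eq ((Finset.sum_congr rfl fun y _ => ?_).trans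
    (Matrix.sum_row_of_mem_rowStochastic hT x))
  rw [Matrix.map_apply, Complex.norm_real, Real.norm_eq_abs,
    abs_of_nonneg (Matrix.nonneg_of_mem_rowStochastic hT)]

theorem norm_one_matrix_le : ‖(1 : Matrix Ω Ω ℂ)‖ ≤ 1 := by
  have h := norm_map_ofReal_le_one (one_mem (Matrix.rowStochastic ℝ Ω))
  rwa [Matrix.map_one _ Complex.ofReal_zero Complex.ofReal_one] at h

/-- A lower bound for `z - T` on vectors is an upper bound for the norm of the resolvent. -/
theorem mul_norm_resolvent_le {T : Matrix Ω Ω ℂ} {z : ℂ} (hz : z ∈ resolventSet ℂ T) {a C : ℝ}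
    (ha : 0 < a) (hC : 0 ≤ C) (h : ∀ u : Ω → ℂ, a * ‖u‖ ≤ C * ‖z • u - T.mulVec u‖) :
    a * ‖resolvent T z‖ ≤ C := by
  have h1 : ‖resolvent T z‖ ≤ C / a := by
    rw [Matrix.linfty_opNorm_eq_opNorm]
    refine ContinuousLinearMap.opNorm_le_bound _ (by positivity) fun u => ?_
    change ‖(resolvent T z).mulVec u‖ ≤ C / a * ‖u‖
    have h2 := h ((resolvent T z).mulVec u)
    have h3 : z • (resolvent T z).mulVec u - T.mulVec ((resolvent T z).mulVec u) = u := by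
      rw [← Matrix.smul_mulVec, smul_resolvent_eq hz, Matrix.add_mulVec, Matrix.one_mulVec,
        Matrix.mulVec_mulVec, add_sub_cancel_right]
    rw [h3] at h2
    rw [div_mul_eq_mul_div, le_div_iff₀ ha]
    linarith
  rw [le_div_iff₀ ha] at h1
  linarith

theorem tendsto_natCast_mul_exp_sub_one (w : ℂ) :
    Tendsto (fun k : ℕ => (k : ℂ) * (Complex.exp (w / k) - 1)) atTop (𝓝 w) := by
  have h1 : HasDerivAt (fun t : ℂ => Complex.exp (w * t)) w 0 := by
    simpa using ((hasDerivAt_id (0 : ℂ)).const_mul w).cexp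
  have h2 : Tendsto (fun k : ℕ => (k : ℂ)⁻¹) atTop (𝓝[≠] 0) := by
    refine tendsto_nhdsWithin_iff.2 ⟨?_, ?_⟩
    · exact tendsto_inv_atTop_nhds_zero_nat (𝕜 := ℂ)
    · filter_upwards [eventually_gt_atTop 0] with k hk
      simpa using hk.ne'
  refine ((hasDerivAt_iff_tendsto_slope_zero.1 h1).comp h2).congr fun k => ?_
  simp [div_eq_mul_inv]

/-- The resolvents of stochastic matrices with monomial asymptotics, at points `1 + O(lam)` of the
right half-plane, converge after rescaling. A complex point is reached from a real one by a single
Neumann series. -/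
theorem exists_tendsto_rescaled_resolvent {T : ℝ → Matrix Ω Ω ℝ}
    (hT : ∀ lam ∈ Set.Ioc (0 : ℝ) 1, T lam ∈ Matrix.rowStochastic ℝ Ω)
    (hreg : ∀ x y, HasMonomialAsymptotics fun lam => T lam x y) {τ : ℝ} (hτ : 0 < τ) (y : ℝ) :
    ∃ F : Matrix Ω Ω ℂ, Tendsto (fun p : ℝ × ℕ => (p.2 : ℂ)⁻¹ •
      resolvent ((T p.1).map Complex.ofReal) (Complex.exp ((1 + y * Complex.I) / p.2)))
      (scaleFilter τ) (𝓝 F) := by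
  -- the disc of centre `s₀` and radius `s₀` contains `(1 + i y) / τ`
  set s₀ : ℝ := (1 + y ^ 2) / τ with hs₀
  have hs₀pos : 0 < s₀ := by positivity
  set s : ℂ := (1 + y * Complex.I) / τ with hs
  have hss₀ : ‖s - s₀‖ < s₀ := by
    have h1 : s - s₀ = ((1 / τ - s₀ : ℝ) : ℂ) + ((y / τ : ℝ) : ℂ) * Complex.I := by
      rw [hs]; push_cast; ring
    refine lt_of_pow_lt_pow_left₀ 2 hs₀pos.le ?_
    rw [← Complex.normSq_eq_norm_sq, h1, Complex.normSq_add_mul_I]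
    have h2 : s₀ = (1 + y ^ 2) * (1 / τ) := by rw [hs₀]; ring
    have h3 : y / τ = y * (1 / τ) := by ring
    have h4 : 0 < 1 / τ := by positivity
    rw [h2, h3]
    nlinarith [mul_pos h4 h4, mul_nonneg (sq_nonneg y) (mul_pos h4 h4).le]
  obtain ⟨V, U, hU, hUV⟩ := exists_tendsto_resolvent hT hreg hs₀pos
  set Uc : ℝ → Matrix Ω Ω ℂ := fun lam => (U lam).map Complex.ofReal with hUc
  set Vc : Matrix Ω Ω ℂ := V.map Complex.ofReal with hVc
  have hUVc : Tendsto Uc (𝓝[>] 0) (𝓝 Vc) :=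
    ((continuous_id.matrix_map Complex.continuous_ofReal).tendsto V).comp hUV
  have hmem : ∀ᶠ lam in 𝓝[>] (0 : ℝ), lam ∈ Set.Ioc (0 : ℝ) 1 := Ioc_mem_nhdsGT one_pos
  have hUceq : ∀ lam ∈ Set.Ioc (0 : ℝ) 1, ((1 + s₀ * lam : ℝ) : ℂ) • Uc lam
      = (lam : ℂ) • (1 : Matrix Ω Ω ℂ) + (T lam).map Complex.ofReal * Uc lam := by
    intro lam hl
    have h1 := congrArg (fun X : Matrix Ω Ω ℝ => X.map Complex.ofReal) (hU lam hl)
    simp only [map_ofReal_mul] at h1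
    have h2 : (((1 + s₀ * lam) • (1 : Matrix Ω Ω ℝ) - T lam)).map Complex.ofReal
        = ((1 + s₀ * lam : ℝ) : ℂ) • (1 : Matrix Ω Ω ℂ) - (T lam).map Complex.ofReal := by
      ext i j
      simp [Matrix.one_apply, apply_ite Complex.ofReal]
    have h3 : (lam • (1 : Matrix Ω Ω ℝ)).map Complex.ofReal
        = (lam : ℂ) • (1 : Matrix Ω Ω ℂ) := by
      ext i j
      simp [Matrix.one_apply, apply_ite Complex.ofReal]
    rw [h2, h3, sub_mul, smul_mul_assoc, one_mul, sub_eq_iff_eq_add] at h1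
    exact h1
  have hUnorm : ∀ lam ∈ Set.Ioc (0 : ℝ) 1, ‖Uc lam‖ ≤ 1 / s₀ := by
    intro lam hl
    have h1 := congrArg norm (hUceq lam hl)
    have hpos : 0 < 1 + s₀ * lam := by have := mul_pos hs₀pos hl.1; linarith
    rw [norm_smul, Complex.norm_real, Real.norm_eq_abs, abs_of_pos hpos] at h1
    have h2 : ‖(lam : ℂ) • (1 : Matrix Ω Ω ℂ)‖ ≤ lam := by
      rw [norm_smul, Complex.norm_real, Real.norm_eq_abs, abs_of_pos hl.1]
      exact mul_le_of_le_one_right hl.1.le norm_one_matrix_le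
    have h3 : ‖(T lam).map Complex.ofReal * Uc lam‖ ≤ ‖Uc lam‖ :=
      (norm_mul_le _ _).trans
        (mul_le_of_le_one_left (norm_nonneg _) (norm_map_ofReal_le_one (hT lam hl)))
    have h4 := h1.le.trans ((norm_add_le _ _).trans (add_le_add h2 h3))
    rw [le_div_iff₀ hs₀pos]
    have h5 : (‖Uc lam‖ * s₀) * lam ≤ 1 * lam := by linarith
    exact le_of_mul_le_mul_right h5 hl.1
  have hVnorm : ‖Vc‖ ≤ 1 / s₀ := le_of_tendsto hUVc.norm (hmem.mono hUnorm)
  have hunit : IsUnit (1 + (s - s₀) • Vc) := by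
    have h1 : ‖-((s - s₀) • Vc)‖ < 1 := by
      rw [norm_neg, norm_smul]
      calc ‖s - s₀‖ * ‖Vc‖ ≤ ‖s - s₀‖ * (1 / s₀) :=
            mul_le_mul_of_nonneg_left hVnorm (norm_nonneg _)
        _ < 1 := by rw [mul_one_div, div_lt_one hs₀pos]; exact hss₀
    simpa using isUnit_one_sub_of_norm_lt_one h1
  refine ⟨(τ : ℂ)⁻¹ • (Vc * Ring.inverse (1 + (s - s₀) • Vc)), ?_⟩
  set z : ℕ → ℂ := fun k => Complex.exp ((1 + y * Complex.I) / k) with hz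
  have hk := tendsto_snd_scaleFilter hτ
  have hmul : Tendsto (fun p : ℝ × ℕ => ((p.2 : ℂ) * p.1)) (scaleFilter τ) (𝓝 (τ : ℂ)) := by
    have := (Complex.continuous_ofReal.tendsto τ).comp (tendsto_mul_scaleFilter τ)
    refine this.congr fun p => ?_
    simp
  have hτc : (τ : ℂ) ≠ 0 := by exact_mod_cast hτ.ne'
  have hX : Tendsto (fun p : ℝ × ℕ => ((z p.2 - 1) / p.1 - s₀ : ℂ)) (scaleFilter τ)
      (𝓝 (s - s₀)) := by
    have h1 := ((tendsto_natCast_mul_exp_sub_one (1 + y * Complex.I)).comp hk).div hmul hτc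
    refine (h1.sub_const (s₀ : ℂ)).congr' ?_
    filter_upwards [hk.eventually_gt_atTop 0,
      (tendsto_fst_scaleFilter τ).eventually self_mem_nhdsWithin] with p hp (hp1 : 0 < p.1)
    have h2 : (p.2 : ℂ) ≠ 0 := by exact_mod_cast hp.ne'
    have h3 : (p.1 : ℂ) ≠ 0 := by exact_mod_cast hp1.ne'
    simp only [Function.comp_apply, hz, Pi.div_apply]
    rw [mul_div_mul_left _ _ h2]
  have hUp := hUVc.comp (tendsto_fst_scaleFilter τ)
  have hY := tendsto_const_nhds (x := (1 : Matrix Ω Ω ℂ)) |>.add (hX.smul hUp)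
  obtain ⟨w, hw⟩ := hunit
  have hinv := (hw ▸ NormedRing.inverse_continuousAt w :
    ContinuousAt Ring.inverse (1 + (s - s₀) • Vc)).tendsto.comp hY
  refine ((hmul.inv₀ hτc).smul (hUp.mul hinv)).congr' ?_
  filter_upwards [hk.eventually_gt_atTop 0, (tendsto_fst_scaleFilter τ).eventually hmem,
    hY.eventually (Units.isOpen.mem_nhds ⟨w, hw⟩)] with p hp hp1 hpunit
  have h2 : (p.2 : ℂ) ≠ 0 := by exact_mod_cast hp.ne'
  have h3 : (p.1 : ℂ) ≠ 0 := by exact_mod_cast hp1.1.ne'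
  set X := 1 + ((z p.2 - 1) / p.1 - s₀ : ℂ) • (Uc ∘ Prod.fst) p with hXdef
  have hres : z p.2 ∈ resolventSet ℂ ((T p.1).map Complex.ofReal) :=
    mem_resolventSet_of_one_lt_norm norm_one_matrix_le (norm_map_ofReal_le_one (hT p.1 hp1))
      (one_lt_norm_exp_div hp y)
  have h4 : (algebraMap ℂ (Matrix Ω Ω ℂ) (z p.2) - (T p.1).map Complex.ofReal) * Uc p.1
      = (p.1 : ℂ) • X := by
    rw [sub_mul, ← Algebra.smul_def, hXdef, smul_add, smul_smul, Function.comp_apply]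
    have h5 : (p.1 : ℂ) * ((z p.2 - 1) / p.1 - s₀) = z p.2 - ((1 + s₀ * p.1 : ℝ) : ℂ) := by
      push_cast
      field_simp
      ring
    rw [h5, sub_smul, hUceq p.1 hp1]
    abel
  have h5 : Uc p.1 = resolvent ((T p.1).map Complex.ofReal) (z p.2) * ((p.1 : ℂ) • X) := by
    rw [← h4, ← mul_assoc, show resolvent ((T p.1).map Complex.ofReal) (z p.2) *
      (algebraMap ℂ (Matrix Ω Ω ℂ) (z p.2) - (T p.1).map Complex.ofReal) = 1 from
        Ring.inverse_mul_cancel _ hres, one_mul]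
  have h6 : Uc p.1 * Ring.inverse X
      = (p.1 : ℂ) • resolvent ((T p.1).map Complex.ofReal) (z p.2) := by
    rw [h5, mul_smul_comm, smul_mul_assoc, mul_assoc, Ring.mul_inverse_cancel X hpunit, mul_one]
  change ((p.2 : ℂ) * p.1)⁻¹ • (Uc p.1 * Ring.inverse X) = _
  rw [h6, smul_smul]
  congr 1
  field_simp

end Convergence

/-! ### Regular families of stochastic matrices -/

section RegularFamily

variable {Ω : Type*} [Fintype Ω] [DecidableEq Ω] {Q : ℝ → Matrix Ω Ω ℝ} {c e : Ω → Ω → ℝ}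

theorem IsRegularFamily.hasMonomialAsymptotics (hQ : IsRegularFamily Q c e) (x y : Ω) :
    HasMonomialAsymptotics fun lam => Q lam x y :=
  ⟨c x y, e x y, hQ.coeff_nonneg x y, hQ.equivalent x y⟩

theorem IsRegularFamily.tendsto_limitMatrix (hQ : IsRegularFamily Q c e) :
    Tendsto Q (𝓝[>] 0) (𝓝 (limitMatrix c e)) := by
  refine tendsto_pi_nhds.2 fun x => tendsto_pi_nhds.2 fun y => ?_
  refine (hQ.equivalent x y).symm.tendsto_nhds ?_
  simp only [limitMatrix, Matrix.of_apply]
  split_ifs with h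
  · simp [h]
  · simpa using (HasMonomialAsymptotics.tendsto_rpow_zero
      (lt_of_le_of_ne (hQ.exponent_nonneg x y) (Ne.symm h))).const_mul (c x y)

theorem eventually_mem_Ioc : ∀ᶠ lam in 𝓝[>] (0 : ℝ), lam ∈ Set.Ioc (0 : ℝ) 1 :=
  Ioc_mem_nhdsGT one_pos

theorem IsRegularFamily.limitMatrix_mem_rowStochastic (hQ : IsRegularFamily Q c e) :
    limitMatrix c e ∈ Matrix.rowStochastic ℝ Ω :=
  isCompact_rowStochastic.isClosed.mem_of_tendsto hQ.tendsto_limitMatrix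
    (eventually_mem_Ioc.mono fun lam hl => hQ.stochastic lam hl)

section Powers

attribute [local instance] Matrix.linftyOpNormedRing Matrix.linftyOpNormedAlgebra

/-- The powers of `Q lam ^ N`, where `N` is the product of the periods, converge on the time scale
`1 / lam`. -/
theorem IsRegularFamily.exists_tendsto_pow (hQ : IsRegularFamily Q c e) {τ : ℝ} (hτ : 0 < τ) :
    ∃ E : Matrix Ω Ω ℝ, Tendsto
      (fun p : ℝ × ℕ => (Q p.1 ^ periodProduct (limitMatrix c e)) ^ p.2) (scaleFilter τ) (𝓝 E) := by
  set N := periodProduct (limitMatrix c e) with hN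
  set T : ℝ → Matrix Ω Ω ℝ := fun lam => Q lam ^ N with hTdef
  have hT : ∀ lam ∈ Set.Ioc (0 : ℝ) 1, T lam ∈ Matrix.rowStochastic ℝ Ω := fun lam hl =>
    pow_mem (hQ.stochastic lam hl) N
  have hreg : ∀ x y, HasMonomialAsymptotics fun lam => T lam x y := fun x y =>
    HasMonomialAsymptotics.matrix_pow hQ.hasMonomialAsymptotics N x y
  have hlim : Tendsto T (𝓝[>] 0) (𝓝 (limitMatrix c e ^ N)) := hQ.tendsto_limitMatrix.pow N
  obtain ⟨C, hC, hritt⟩ := exists_ritt_bound hQ.limitMatrix_mem_rowStochastic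
  choose F hF using fun y : ℝ => exists_tendsto_rescaled_resolvent hT hreg hτ y
  have hmem := (tendsto_fst_scaleFilter τ).eventually eventually_mem_Ioc
  have hlimc := tendsto_pow_of_tendsto_resolvent (l := scaleFilter τ)
    (a := fun p : ℝ × ℕ => (T p.1).map Complex.ofReal) (k := Prod.snd) (C := C) (F := F)
    norm_one_matrix_le (tendsto_snd_scaleFilter hτ)
    (hmem.mono fun p hp => norm_map_ofReal_le_one (hT p.1 hp))
    (by
      filter_upwards [hmem, (hlim.comp (tendsto_fst_scaleFilter τ)).eventually hritt]
        with p hp hp2 z hz hz3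
      have hz1 : z - 1 ≠ 0 := by
        intro h
        rw [sub_eq_zero.1 h] at hz
        simp at hz
      exact mul_norm_resolvent_le (mem_resolventSet_of_one_lt_norm norm_one_matrix_le
        (norm_map_ofReal_le_one (hT p.1 hp)) hz) (norm_pos_iff.2 hz1) hC.le
        (hp2 (hT p.1 hp) z hz.le hz3))
    hF
  have hre := ((continuous_id.matrix_map Complex.continuous_re).tendsto _).comp hlimc
  refine ⟨_, hre.congr fun p => ?_⟩
  rw [Function.comp_apply, ← map_ofReal_pow]
  ext x y
  simp [hTdef]

end Powers

/-- The average of the first `n` powers of `S`. -/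
noncomputable def powerAverage (S : Matrix Ω Ω ℝ) (n : ℕ) : Matrix Ω Ω ℝ :=
  (n : ℝ)⁻¹ • ∑ m ∈ Finset.range n, S ^ m

theorem smul_sum_pow_add (S : Matrix Ω Ω ℝ) (n k : ℕ) :
    (n : ℝ)⁻¹ • ∑ m ∈ Finset.range n, S ^ (k + m) = S ^ k * powerAverage S n := by
  simp only [powerAverage, mul_smul_comm, Finset.mul_sum, pow_add]

theorem continuous_powerAverage (n : ℕ) :
    Continuous fun S : Matrix Ω Ω ℝ => powerAverage S n := by
  unfold powerAverage
  fun_prop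

theorem commute_powerAverage (S : Matrix Ω Ω ℝ) (n : ℕ) : Commute S (powerAverage S n) :=
  (Commute.sum_right _ _ _ fun m _ => Commute.self_pow S m).smul_right _

theorem commute_powerAverage_powerAverage (S : Matrix Ω Ω ℝ) (n m : ℕ) :
    Commute (powerAverage S n) (powerAverage S m) :=
  (Commute.sum_left _ _ _ fun k _ => (commute_powerAverage S m).pow_left k).smul_left _

theorem mul_powerAverage_of_mul_eq {S Y : Matrix Ω Ω ℝ} (h : Y * S = Y) {n : ℕ} (hn : 0 < n) :
    Y * powerAverage S n = Y := by
  have hpow : ∀ m : ℕ, Y * S ^ m = Y := fun m => by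
    induction m with
    | zero => simp
    | succ m ih => rw [pow_succ, ← mul_assoc, ih, h]
  have hn0 : (n : ℝ) ≠ 0 := by exact_mod_cast hn.ne'
  simp only [powerAverage, mul_smul_comm, Finset.mul_sum, hpow, Finset.sum_const,
    Finset.card_range]
  rw [← Nat.cast_smul_eq_nsmul ℝ, smul_smul, inv_mul_cancel₀ hn0, one_smul]

theorem mul_powerAverage (S : Matrix Ω Ω ℝ) {n : ℕ} :
    S * powerAverage S n = powerAverage S n + (n : ℝ)⁻¹ • (S ^ n - 1) := by
  have h1 := (Finset.sum_range_succ (fun m => S ^ m) n).symm.trans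
    (Finset.sum_range_succ' (fun m => S ^ m) n)
  simp only [powerAverage, mul_smul_comm, Finset.mul_sum, ← pow_succ', ← smul_add]
  congr 1
  rw [pow_zero] at h1
  rw [← add_sub_assoc, h1, add_sub_cancel_right]

theorem powerAverage_mem_rowStochastic {S : Matrix Ω Ω ℝ} (hS : S ∈ Matrix.rowStochastic ℝ Ω)
    {n : ℕ} (hn : 0 < n) : powerAverage S n ∈ Matrix.rowStochastic ℝ Ω := by
  have hn0 : (n : ℝ) ≠ 0 := by exact_mod_cast hn.ne'
  rw [Matrix.mem_rowStochastic_iff_sum]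
  simp only [powerAverage, Matrix.smul_apply, Matrix.sum_apply, smul_eq_mul]
  refine ⟨fun x y => mul_nonneg (by positivity) (Finset.sum_nonneg fun m _ =>
    Matrix.nonneg_of_mem_rowStochastic (pow_mem hS m)), fun x => ?_⟩
  rw [← Finset.mul_sum, Finset.sum_comm]
  simp only [Matrix.sum_row_of_mem_rowStochastic (pow_mem hS _), Finset.sum_const,
    Finset.card_range, nsmul_eq_mul, mul_one]
  exact inv_mul_cancel₀ hn0

theorem tendsto_div_mul_scaleFilter {N : ℕ} (hN : 0 < N) (t : ℝ) :
    Tendsto (fun p : ℝ × ℕ => (p.1, p.2 / N)) (scaleFilter t) (scaleFilter (t / N)) := by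
  have hN0 : (0 : ℝ) < N := by exact_mod_cast hN
  refine tendsto_scaleFilter (tendsto_fst_scaleFilter t) ?_
  have hfst : Tendsto (fun p : ℝ × ℕ => p.1) (scaleFilter t) (𝓝 0) :=
    (tendsto_fst_scaleFilter t).mono_right nhdsWithin_le_nhds
  have h1 := (tendsto_mul_scaleFilter t).div_const (N : ℝ)
  have h2 : Tendsto (fun p : ℝ × ℕ => (p.2 : ℝ) * p.1 / N - p.1) (scaleFilter t) (𝓝 (t / N)) := by
    simpa using h1.sub hfst
  have hpos := (tendsto_fst_scaleFilter t).eventually self_mem_nhdsWithin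
  refine tendsto_of_tendsto_of_tendsto_of_le_of_le' h2 h1 ?_ ?_
  · filter_upwards [hpos] with p (hp : 0 < p.1)
    have h3 : (p.2 : ℝ) < N * ((p.2 / N : ℕ) + 1) := by
      exact_mod_cast Nat.lt_mul_div_succ p.2 hN
    have h4 : (p.2 : ℝ) / N ≤ (p.2 / N : ℕ) + 1 := by
      rw [div_le_iff₀ hN0]; linarith
    have h5 := mul_le_mul_of_nonneg_right h4 hp.le
    calc (p.2 : ℝ) * p.1 / N - p.1 = (p.2 : ℝ) / N * p.1 - p.1 := by ring
      _ ≤ _ := by linarith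
  · filter_upwards [hpos] with p (hp : 0 < p.1)
    calc ((p.2 / N : ℕ) : ℝ) * p.1 ≤ (p.2 : ℝ) / N * p.1 :=
          mul_le_mul_of_nonneg_right Nat.cast_div_le hp.le
      _ = _ := by ring

/-- The averages over `N` stages converge on the time scale `1 / lam`. Their limit at time `t` is
`E * powerAverage S N`, where `S` is the limit matrix and `E` is the limit of the
powers `Q lam ^ (N k)`, `k * lam → t / N`; it is invariant under `S`. -/
theorem IsRegularFamily.exists_tendsto_average (hQ : IsRegularFamily Q c e) {t : ℝ} (ht : 0 < t) :
    ∃ E B : Matrix Ω Ω ℝ,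
      Tendsto (fun p : ℝ × ℕ => (Q p.1 ^ periodProduct (limitMatrix c e)) ^ p.2)
        (scaleFilter (t / periodProduct (limitMatrix c e))) (𝓝 E) ∧
      E * powerAverage (limitMatrix c e) (periodProduct (limitMatrix c e)) = B ∧
      B * limitMatrix c e = B ∧
      Tendsto (fun p : ℝ × ℕ => Q p.1 ^ p.2 *
        powerAverage (Q p.1) (periodProduct (limitMatrix c e))) (scaleFilter t) (𝓝 B) := by
  set S := limitMatrix c e with hS
  set N := periodProduct S with hN
  have hNpos : 0 < N := periodProduct_pos hQ.limitMatrix_mem_rowStochastic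
  have hN0 : (0 : ℝ) < N := by exact_mod_cast hNpos
  obtain ⟨E, hE⟩ := hQ.exists_tendsto_pow (div_pos ht hN0)
  have hQ0 : ∀ τ, Tendsto (fun p : ℝ × ℕ => Q p.1) (scaleFilter τ) (𝓝 S) := fun τ =>
    hQ.tendsto_limitMatrix.comp (tendsto_fst_scaleFilter τ)
  -- shifting `k` by one does not change the limit `E`, so that `E` is invariant under `S ^ N`
  have hES : E * S ^ N = E := by
    have hshift : Tendsto (fun p : ℝ × ℕ => (p.1, p.2 + 1)) (scaleFilter (t / N))
        (scaleFilter (t / N)) := by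
      refine tendsto_scaleFilter (tendsto_fst_scaleFilter _) ?_
      have hfst : Tendsto (fun p : ℝ × ℕ => p.1) (scaleFilter (t / N)) (𝓝 0) :=
        (tendsto_fst_scaleFilter _).mono_right nhdsWithin_le_nhds
      have h1 := (tendsto_mul_scaleFilter (t / N)).add hfst
      rw [add_zero] at h1
      refine h1.congr fun p => ?_
      push_cast
      ring
    have hne : (scaleFilter (t / N)).NeBot :=
      (tendsto_floor_scaleFilter (div_pos ht hN0).le).neBot
    refine tendsto_nhds_unique (hE.mul ((hQ0 _).pow N)) ((hE.comp hshift).congr fun p => ?_)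
    rw [Function.comp_apply, pow_succ]
  have hB : E * powerAverage S N * S = E * powerAverage S N := by
    rw [mul_assoc, ← (commute_powerAverage S N).eq, mul_powerAverage, mul_add, mul_smul_comm,
      mul_sub, hES, mul_one, sub_self, smul_zero, add_zero]
  have hBpow : ∀ j : ℕ, E * powerAverage S N * S ^ j = E * powerAverage S N := fun j => by
    induction j with
    | zero => rw [pow_zero, mul_one]
    | succ j ih => rw [pow_succ, ← mul_assoc, ih, hB]
  refine ⟨E, E * powerAverage S N, hE, rfl, hB, ?_⟩
  have hj : ∀ j : ℕ, Tendsto (fun p : ℝ × ℕ => (Q p.1 ^ N) ^ (p.2 / N) * Q p.1 ^ j *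
      powerAverage (Q p.1) N) (scaleFilter t) (𝓝 (E * powerAverage S N)) := by
    intro j
    have h1 := ((hE.comp (tendsto_div_mul_scaleFilter hNpos t)).mul ((hQ0 t).pow j)).mul
      (((continuous_powerAverage N).tendsto S).comp (hQ0 t))
    have h2 : E * S ^ j * powerAverage S N = E * powerAverage S N := by
      rw [mul_assoc, ((commute_powerAverage S N).pow_left j).eq, ← mul_assoc, hBpow]
    rw [h2] at h1
    exact h1
  refine tendsto_def.2 fun W hW => ?_
  have hall : ∀ᶠ p in scaleFilter t, ∀ j ∈ Finset.range N,
      (Q p.1 ^ N) ^ (p.2 / N) * Q p.1 ^ j * powerAverage (Q p.1) N ∈ W :=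
    (eventually_all_finset _).2 fun j _ => (hj j).eventually hW
  filter_upwards [hall] with p hp
  have h1 := hp (p.2 % N) (Finset.mem_range.2 (Nat.mod_lt _ hNpos))
  rwa [← pow_mul, ← pow_add, Nat.div_add_mod] at h1

end RegularFamily

/-! ### The position at time `t` -/

section Position

variable {Ω : Type*} [Fintype Ω] [DecidableEq Ω] {Q : ℝ → Matrix Ω Ω ℝ} {c e : Ω → Ω → ℝ}

/-- `(n + m) * lam` tends to `s + t` when `n = ⌊s / lam⌋` and `m = ⌊t / lam⌋`. -/
theorem tendsto_floor_add_floor_scaleFilter {s t : ℝ} (hs : 0 ≤ s) (ht : 0 ≤ t) :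
    Tendsto (fun lam : ℝ => (lam, ⌊s / lam⌋₊ + ⌊t / lam⌋₊)) (𝓝[>] 0) (scaleFilter (s + t)) := by
  refine tendsto_scaleFilter tendsto_id ?_
  have h := ((tendsto_mul_scaleFilter s).comp (tendsto_floor_scaleFilter hs)).add
    ((tendsto_mul_scaleFilter t).comp (tendsto_floor_scaleFilter ht))
  refine h.congr fun lam => ?_
  simp only [Function.comp_apply, Nat.cast_add, add_mul]

/-- A limit along `scaleFilter t` is a continuous function of `t`, since a property that holds along
`scaleFilter t` holds along `scaleFilter τ` for `τ` near `t`. -/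
theorem continuousAt_of_tendsto_scaleFilter {X : Type*} [TopologicalSpace X] [RegularSpace X]
    {f : ℝ × ℕ → X} {B : ℝ → X} (h : ∀ t, 0 < t → Tendsto f (scaleFilter t) (𝓝 (B t))) {t : ℝ}
    (ht : 0 < t) : ContinuousAt B t := by
  refine (closed_nhds_basis (B t)).tendsto_right_iff.2 fun U hU => ?_
  filter_upwards [((h t ht).eventually hU.1).scaleFilter_nhds, lt_mem_nhds ht] with τ h1 h2
  exact hU.2.mem_of_tendsto ((h τ h2).comp (tendsto_floor_scaleFilter h2.le))
    ((tendsto_floor_scaleFilter h2.le).eventually h1)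

/-- The semigroup property of limits of averages: the product of two averaged powers is an averaged
power times one more average, which is absorbed in the limit. -/
theorem IsRegularFamily.average_add (hQ : IsRegularFamily Q c e) {N : ℕ} (hN : 0 < N) {s t : ℝ}
    (hs : 0 ≤ s) (ht : 0 ≤ t) {X Y Z : Matrix Ω Ω ℝ}
    (hX : Tendsto (fun p : ℝ × ℕ => Q p.1 ^ p.2 * powerAverage (Q p.1) N) (scaleFilter s) (𝓝 X))
    (hY : Tendsto (fun p : ℝ × ℕ => Q p.1 ^ p.2 * powerAverage (Q p.1) N) (scaleFilter t) (𝓝 Y))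
    (hZ : Tendsto (fun p : ℝ × ℕ => Q p.1 ^ p.2 * powerAverage (Q p.1) N) (scaleFilter (s + t))
      (𝓝 Z)) (hZS : Z * limitMatrix c e = Z) : Z = X * Y := by
  have h1 := (hZ.comp (tendsto_floor_add_floor_scaleFilter hs ht)).mul
    (((continuous_powerAverage N).tendsto _).comp hQ.tendsto_limitMatrix)
  rw [mul_powerAverage_of_mul_eq hZS hN] at h1
  refine tendsto_nhds_unique h1 (((hX.comp (tendsto_floor_scaleFilter hs)).mul
    (hY.comp (tendsto_floor_scaleFilter ht))).congr fun lam => ?_)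
  simp only [Function.comp_apply]
  rw [pow_add, mul_assoc, ← mul_assoc (powerAverage (Q lam) N),
    ← ((commute_powerAverage (Q lam) N).pow_left _).eq]
  simp only [mul_assoc]

/-- A limit of averages over `n` stages can only be the limit of the averages over `N` stages:
sampling at discount rates `t / (N i + j)` shows that it equals `E * S ^ j * powerAverage S n` for
every `j`, so that it is invariant under `S`. -/
theorem IsRegularFamily.averagedPosition_eq (hQ : IsRegularFamily Q c e) {t : ℝ} (ht : 0 < t)
    {E B B' : Matrix Ω Ω ℝ}
    (hE : Tendsto (fun p : ℝ × ℕ => (Q p.1 ^ periodProduct (limitMatrix c e)) ^ p.2)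
        (scaleFilter (t / periodProduct (limitMatrix c e))) (𝓝 E))
    (hEB : E * powerAverage (limitMatrix c e) (periodProduct (limitMatrix c e)) = B)
    (hB : B * limitMatrix c e = B) {n : ℕ} (hn : 0 < n) (hB' : IsAveragedPosition Q n t B') :
    B' = B := by
  set S := limitMatrix c e with hS
  set N := periodProduct S with hN
  have hNpos : 0 < N := periodProduct_pos hQ.limitMatrix_mem_rowStochastic
  have hN0 : (0 : ℝ) < N := by exact_mod_cast hNpos
  have hkey : ∀ j : ℕ, B' = E * (S ^ j * powerAverage S n) := by
    intro j
    have hden : Tendsto (fun i : ℕ => (((N * i + j : ℕ)) : ℝ)) atTop atTop :=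
      tendsto_natCast_atTop_atTop.comp (tendsto_atTop_mono
        (fun i => (Nat.le_mul_of_pos_left i hNpos).trans (Nat.le_add_right _ j)) tendsto_id)
    have hlam : Tendsto (fun i : ℕ => t / ((N * i + j : ℕ) : ℝ)) atTop (𝓝[>] 0) := by
      refine tendsto_nhdsWithin_iff.2 ⟨hden.const_div_atTop t, ?_⟩
      filter_upwards [hden.eventually_gt_atTop 0] with i hi
      exact div_pos ht hi
    have hfl : ∀ᶠ i : ℕ in atTop, ⌊t / (t / ((N * i + j : ℕ) : ℝ))⌋₊ = N * i + j := by
      filter_upwards [hden.eventually_gt_atTop 0] with i hi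
      rw [div_div_cancel₀ ht.ne', Nat.floor_natCast]
    have hscale : Tendsto (fun i : ℕ => (t / ((N * i + j : ℕ) : ℝ), i)) atTop
        (scaleFilter (t / N)) := by
      refine tendsto_scaleFilter hlam ?_
      have h1 : Tendsto (fun i : ℕ => t / N - j / N * (t / ((N * i + j : ℕ) : ℝ))) atTop
          (𝓝 (t / N)) := by
        simpa using ((hlam.mono_right nhdsWithin_le_nhds).const_mul ((j : ℝ) / N)).const_sub (t / N)
      refine h1.congr' ?_
      filter_upwards [hden.eventually_gt_atTop 0] with i hi
      push_cast at hi ⊢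
      field_simp
      ring
    have h1 : Tendsto (fun i : ℕ => Q (t / ((N * i + j : ℕ) : ℝ)) ^ (N * i + j) *
        powerAverage (Q (t / ((N * i + j : ℕ) : ℝ))) n) atTop (𝓝 B') := by
      refine (Tendsto.comp hB' hlam).congr' ?_
      filter_upwards [hfl] with i hi
      rw [Function.comp_apply, hi, smul_sum_pow_add]
    have hQ0 := hQ.tendsto_limitMatrix.comp hlam
    have h2 := (hE.comp hscale).mul ((hQ0.pow j).mul
      (((continuous_powerAverage n).tendsto S).comp hQ0))
    refine tendsto_nhds_unique h1 (h2.congr fun i => ?_)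
    simp only [Function.comp_apply]
    rw [pow_add, pow_mul, mul_assoc]
  have h0 : B' = E * powerAverage S n := by simpa using hkey 0
  have hinv : B' * S = B' := by
    rw [h0, mul_assoc, ← (commute_powerAverage S n).eq, ← h0, hkey 1, pow_one]
  rw [← mul_powerAverage_of_mul_eq hinv hNpos, h0, mul_assoc,
    (commute_powerAverage_powerAverage S n N).eq, ← mul_assoc, hEB,
    mul_powerAverage_of_mul_eq hB hn]

/-- A continuous semigroup of stochastic matrices on `(0, ∞)` extends continuously to `[0, ∞)`. -/
theorem exists_semigroup_extension {B : ℝ → Matrix Ω Ω ℝ}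
    (hstoch : ∀ t, 0 < t → B t ∈ Matrix.rowStochastic ℝ Ω)
    (hadd : ∀ s t, 0 < s → 0 < t → B (s + t) = B s * B t)
    (hcont : ∀ t, 0 < t → ContinuousAt B t) :
    ∃ P : ℝ → Matrix Ω Ω ℝ, (∀ t, 0 < t → P t = B t) ∧ Tendsto P (𝓝[>] 0) (𝓝 (P 0)) ∧
      (∀ t, 0 ≤ t → P t ∈ Matrix.rowStochastic ℝ Ω) ∧
      (∀ s t, 0 ≤ s → 0 ≤ t → P (s + t) = P s * P t) ∧ ContinuousOn P (Set.Ici 0) := by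
  obtain ⟨E₀, hE₀, hzero, hidem, hE₀B⟩ := exists_tendsto_zero_of_semigroup hstoch hadd hcont
  obtain ⟨P, hP, hP0⟩ : ∃ P : ℝ → Matrix Ω Ω ℝ, (∀ t, 0 < t → P t = B t) ∧ P 0 = E₀ :=
    ⟨fun t => if t ≤ 0 then E₀ else B t, fun t ht => if_neg ht.not_ge, if_pos le_rfl⟩
  have hlim : Tendsto P (𝓝[>] 0) (𝓝 (P 0)) := by
    rw [hP0]
    exact hzero.congr' (eventually_mem_nhdsWithin.mono fun t ht => (hP t ht).symm)
  refine ⟨P, hP, hlim, fun t ht => ?_, fun s t hs ht => ?_, fun t ht => ?_⟩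
  · rcases ht.eq_or_lt with rfl | h
    · rwa [hP0]
    · rw [hP t h]
      exact hstoch t h
  · rcases hs.eq_or_lt with rfl | hs'
    · rcases ht.eq_or_lt with rfl | ht'
      · rw [add_zero, hP0, hidem]
      · rw [zero_add, hP0, hP t ht', (hE₀B t ht').1]
    · rcases ht.eq_or_lt with rfl | ht'
      · rw [add_zero, hP0, hP s hs', (hE₀B s hs').2]
      · rw [hP s hs', hP t ht', hP _ (add_pos hs' ht')]
        exact hadd s t hs' ht'
  · rcases (Set.mem_Ici.1 ht).eq_or_lt with rfl | h
    · exact continuousWithinAt_Ioi_iff_Ici.1 hlim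
    · refine ((hcont t h).congr ?_).continuousWithinAt
      filter_upwards [lt_mem_nhds h] with τ hτ using (hP τ hτ).symm

/-- The position exists and is a continuous semigroup of stochastic matrices. -/
theorem IsRegularFamily.exists_isPosition (hQ : IsRegularFamily Q c e) :
    ∃ P : ℝ → Matrix Ω Ω ℝ, IsPosition Q c e P ∧
      (∀ t, 0 ≤ t → P t ∈ Matrix.rowStochastic ℝ Ω) ∧
      (∀ s t, 0 ≤ s → 0 ≤ t → P (s + t) = P s * P t) ∧ ContinuousOn P (Set.Ici 0) := by
  have hNpos : 0 < periodProduct (limitMatrix c e) :=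
    periodProduct_pos hQ.limitMatrix_mem_rowStochastic
  have hex : ∀ t : ℝ, ∃ E B : Matrix Ω Ω ℝ, 0 < t →
      Tendsto (fun p : ℝ × ℕ => (Q p.1 ^ periodProduct (limitMatrix c e)) ^ p.2)
        (scaleFilter (t / periodProduct (limitMatrix c e))) (𝓝 E) ∧
      E * powerAverage (limitMatrix c e) (periodProduct (limitMatrix c e)) = B ∧
      B * limitMatrix c e = B ∧
      Tendsto (fun p : ℝ × ℕ => Q p.1 ^ p.2 *
        powerAverage (Q p.1) (periodProduct (limitMatrix c e))) (scaleFilter t) (𝓝 B) := fun t => by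
    by_cases ht : 0 < t
    · obtain ⟨E, B, h⟩ := hQ.exists_tendsto_average ht
      exact ⟨E, B, fun _ => h⟩
    · exact ⟨0, 0, fun h => absurd h ht⟩
  choose E B hEB using hex
  have hlim := fun t ht => (hEB t ht).2.2.2
  have hBS := fun t ht => (hEB t ht).2.2.1
  have hfloor := fun t ht => (hlim t ht).comp (tendsto_floor_scaleFilter ht.le)
  have hstoch : ∀ t, 0 < t → B t ∈ Matrix.rowStochastic ℝ Ω := fun t ht =>
    isCompact_rowStochastic.isClosed.mem_of_tendsto (hfloor t ht)
      (eventually_mem_Ioc.mono fun lam hl => mul_mem (pow_mem (hQ.stochastic lam hl) _)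
        (powerAverage_mem_rowStochastic (hQ.stochastic lam hl) hNpos))
  have hadd : ∀ s t, 0 < s → 0 < t → B (s + t) = B s * B t := fun s t hs ht =>
    hQ.average_add hNpos hs.le ht.le (hlim s hs) (hlim t ht) (hlim _ (add_pos hs ht))
      (hBS _ (add_pos hs ht))
  have hcont : ∀ t, 0 < t → ContinuousAt B t := fun t ht =>
    continuousAt_of_tendsto_scaleFilter hlim ht
  obtain ⟨P, hP, hP0, hPstoch, hPadd, hPcont⟩ := exists_semigroup_extension hstoch hadd hcont
  refine ⟨P, ⟨fun t ht => ?_, fun t ht n hn B' hB' => ?_, hP0⟩, hPstoch, hPadd, hPcont⟩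
  · rw [hP t ht]
    exact (hfloor t ht).congr fun lam => (smul_sum_pow_add _ _ _).symm
  · rw [hP t ht]
    exact hQ.averagedPosition_eq ht (hEB t ht).1 (hEB t ht).2.1 (hBS t ht) hn hB'

end Position

theorem mainTheorem9 {Ω : Type*} [Fintype Ω] [DecidableEq Ω]
    (Q : ℝ → Matrix Ω Ω ℝ) (c e : Ω → Ω → ℝ) (hQ : IsRegularFamily Q c e) :
    ∃ P : ℝ → Matrix Ω Ω ℝ, IsPosition Q c e P ∧
      (∃ (L : ℕ) (R : Fin L → Finset Ω) (μ : Matrix Ω (Fin L) ℝ)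
        (A : Matrix (Fin L) (Fin L) ℝ) (M : Matrix (Fin L) Ω ℝ),
        L ≤ Fintype.card Ω ∧ IsRepresentation P R μ A M) ∧
      ∀ (L : ℕ) (R : Fin L → Finset Ω) (μ : Matrix Ω (Fin L) ℝ)
        (A : Matrix (Fin L) (Fin L) ℝ) (M : Matrix (Fin L) Ω ℝ),
        IsRepresentation P R μ A M →
          ∀ (r : ℕ) (v : Fin r → ℂ) (m : Fin r → ℕ),
            HasJordanForm (A.map (fun a : ℝ => (a : ℂ))) v m →
              ∃ a : Fin r → ℕ → Ω → Ω → ℂ, ∀ t ∈ Set.Ico (0 : ℝ) 1, ∀ x y : Ω,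
                ((positionAtFraction P t x y : ℝ) : ℂ) =
                  ∑ i, ∑ k ∈ Finset.range (m i),
                    a i k x y * (((1 - t : ℝ) : ℂ) ^ (-v i) * ((Real.log (1 - t) : ℝ) : ℂ) ^ k) := by
  obtain ⟨P, hpos, hstoch, hadd, hcont⟩ := hQ.exists_isPosition
  exact ⟨P, hpos, exists_isRepresentation hstoch hadd hcont,
    fun L R μ A M hrep r v m hJ => exists_jordan_expansion hrep hJ⟩
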